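/- Let $(M,g)$ and $(N,h)$ be smooth finite-dimensional Riemannian manifolds without boundary, $\varphi\colon M\to N$ a smooth submersion, $n=\dim N$, and let $B\subset N$ be an (embedded) smooth submanifold of codimension $p$; then $\varphi^{-1}(B)$ is a submanifold of $M$ of codimension $p$. Suppose that $\varphi$ is horizontally conformal to first order at every $x\in\varphi^{-1}(B)$, i.e. near each such $x$ the $n$ non-zero eigenvalues (with multiplicity) of the first fundamental form $\varphi^*h$ with respect to $g$ can be enumerated as functions $\lambda_1,\dots,\lambda_n$ that are differentiable at $x$ and satisfy $$\lambda_1(x)=\dots=\lambda_n(x),\qquad \nabla\lambda_1(x)=\dots=\nabla\lambda_n(x).$$ Let $\|d\varphi\|$ be the Hilbert–Schmidt norm of $d\varphi$, let $\tau(\varphi)=\operatorname{Tr}(\nabla d\varphi)$ be the tension field, and let $$\tau_p(\varphi)=\|d\varphi\|^{p-2}\bigl(\tau(\varphi)+(p-2)\,d\varphi(\nabla\ln\|d\varphi\|)\bigr)$$ be the $p$-tension field. A submanifold is called minimal if its mean curvature vector, the trace of its second fundamental form, vanishes identically. Consider the statements (i) $\tau_p(\varphi)(x)\in T_{\varphi(x)}B$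 for all $x\in\varphi^{-1}(B)$; (ii) $B$ is minimal in $N$; (iii) $\varphi^{-1}(B)$ is minimal in $M$. Then (i) and (ii) imply (iii); (ii) and (iii) imply (i); and, if $B\subset\varphi(M)$, then (i) and (iii) imply (ii). -/

import Mathlib

open Bundle
open scoped Manifold ContDiff Topology

noncomputable section

namespace RiemGeom

/-! Throughout, manifolds are modelled (without boundary) on finite-dimensional real normed spaces,
and the Riemannian metric is the inner product on the tangent spaces given by Mathlib's
`RiemannianBundle`. -/

instance finiteDimensionalTangentSpace {F : Type*} [NormedAddCommGroup F] [NormedSpace ℝ F]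
    [FiniteDimensional ℝ F] {N : Type*} [TopologicalSpace N] [ChartedSpace F N] (y : N) :
    FiniteDimensional ℝ (TangentSpace 𝓘(ℝ, F) y) :=
  inferInstanceAs (FiniteDimensional ℝ F)

section Connection

variable {E : Type*} [NormedAddCommGroup E] [NormedSpace ℝ E]
  {F : Type*} [NormedAddCommGroup F] [NormedSpace ℝ F] [FiniteDimensional ℝ F]
  {M : Type*} [TopologicalSpace M] [ChartedSpace E M] [IsManifold 𝓘(ℝ, E) ∞ M]
  {N : Type*} [TopologicalSpace N] [ChartedSpace F N] [IsManifold 𝓘(ℝ, F) ∞ N]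

/-- The coordinate vector field near `y`, i.e. the vector field with constant coefficients in the
preferred chart at `y`, whose value at `y` is `v`. -/
def coordField {y : N} (v : TangentSpace 𝓘(ℝ, F) y) : Π z : N, TangentSpace 𝓘(ℝ, F) z :=
  FiberBundle.extend F v

/-- The components, in the preferred chart of `N` at `y`, of the tangent vector `v` at `z`. -/
def coords (y : N) {z : N} (v : TangentSpace 𝓘(ℝ, F) z) : F :=
  (trivializationAt F (TangentSpace 𝓘(ℝ, F) : N → Type _) y ⟨z, v⟩).2

/-- The tangent vector at `y` with the given components in the preferred chart of `N` at `y`. -/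
def ofCoords (y : N) (u : F) : TangentSpace 𝓘(ℝ, F) y :=
  (trivializationAt F (TangentSpace 𝓘(ℝ, F) : N → Type _) y).symmL ℝ y u

variable [RiemannianBundle (fun y : N ↦ TangentSpace 𝓘(ℝ, F) y)]

/-- The function `z ↦ h(V, W)(z)` for the coordinate vector fields `V`, `W` of the chart at `y` that
extend `v` and `w`: a component of the metric in the chart at `y`. -/
def metricCoeff {y : N} (v w : TangentSpace 𝓘(ℝ, F) y) (z : N) : ℝ :=
  inner ℝ (coordField v z) (coordField w z)

/-- The Christoffel symbol of the first kind in the chart at `y`: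
`½ (∂_v h(W, Z) + ∂_w h(V, Z) - ∂_z h(V, W))` at `y`. This is the right-hand side of Koszul's formula
for `h(∇_V W, Z)`, where `V`, `W`, `Z` are (commuting) coordinate fields extending `v`, `w`, `z`. -/
def koszul {y : N} (v w z : TangentSpace 𝓘(ℝ, F) y) : ℝ :=
  (1 / 2) * (mvfderiv 𝓘(ℝ, F) (metricCoeff w z) y v + mvfderiv 𝓘(ℝ, F) (metricCoeff v z) y w
    - mvfderiv 𝓘(ℝ, F) (metricCoeff v w) y z)

/-- The Christoffel symbol `Γ(v, w) = ∇_V W (y)` of the chart at `y`, for the Levi-Civita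
connection: the vector with `h(Γ(v, w), z) = koszul v w z` for all `z`. -/
def christoffel {y : N} (v w : TangentSpace 𝓘(ℝ, F) y) : TangentSpace 𝓘(ℝ, F) y :=
  let e := stdOrthonormalBasis ℝ (TangentSpace 𝓘(ℝ, F) y)
  ∑ k, koszul v w (e k) • e k

/-- The pull-back `∇^{φ*}` of the Levi-Civita connection of `N` along `φ : M → N`:
the covariant derivative at `x` in direction `v` of a section `s` of `φ^*(TN)`. In the chart at
`φ x` its components are `∂_v s + Γ(dφ v, s)`. -/
def pullbackConn (φ : M → N) (s : Π x : M, TangentSpace 𝓘(ℝ, F) (φ x)) (x : M)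
    (v : TangentSpace 𝓘(ℝ, E) x) : TangentSpace 𝓘(ℝ, F) (φ x) :=
  ofCoords (φ x) (mvfderiv 𝓘(ℝ, E) (fun x' ↦ coords (φ x) (s x')) x v)
    + christoffel (mfderiv 𝓘(ℝ, E) 𝓘(ℝ, F) φ x v) (s x)

/-- The Levi-Civita connection of `N`: `leviCivita Y y v` is `∇_v Y` at `y`. Its components in the
chart at `y` are `∂_v Y + Γ(v, Y)`. -/
def leviCivita (Y : Π y : N, TangentSpace 𝓘(ℝ, F) y) (y : N)
    (v : TangentSpace 𝓘(ℝ, F) y) : TangentSpace 𝓘(ℝ, F) y :=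
  ofCoords y (mvfderiv 𝓘(ℝ, F) (fun z ↦ coords y (Y z)) y v) + christoffel v (Y y)

end Connection

section Tension

variable {E : Type*} [NormedAddCommGroup E] [NormedSpace ℝ E] [FiniteDimensional ℝ E]
  {F : Type*} [NormedAddCommGroup F] [NormedSpace ℝ F] [FiniteDimensional ℝ F]
  {M : Type*} [TopologicalSpace M] [ChartedSpace E M] [IsManifold 𝓘(ℝ, E) ∞ M]
  [RiemannianBundle (fun x : M ↦ TangentSpace 𝓘(ℝ, E) x)]
  {N : Type*} [TopologicalSpace N] [ChartedSpace F N] [IsManifold 𝓘(ℝ, F) ∞ N]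
  [RiemannianBundle (fun y : N ↦ TangentSpace 𝓘(ℝ, F) y)]

/-- The gradient of `f : M → ℝ` at `x`. -/
def grad (f : M → ℝ) (x : M) : TangentSpace 𝓘(ℝ, E) x :=
  let e := stdOrthonormalBasis ℝ (TangentSpace 𝓘(ℝ, E) x)
  ∑ i, mvfderiv 𝓘(ℝ, E) f x (e i) • e i

variable (E F) in
/-- The Hilbert-Schmidt norm `‖dφ‖` of the differential of `φ` at `x`. -/
def diffNorm (φ : M → N) (x : M) : ℝ :=
  let e := stdOrthonormalBasis ℝ (TangentSpace 𝓘(ℝ, E) x)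
  √(∑ i, ‖mfderiv 𝓘(ℝ, E) 𝓘(ℝ, F) φ x (e i)‖ ^ 2)

/-- The second fundamental form of a map, `∇dφ(v, w) = ∇^{φ*}_v(dφ W) - dφ(∇_v W)` at `x`, where `W`
is a vector field extending `w`; it does not depend on the extension. -/
def nablaDiff (φ : M → N) (x : M) (v w : TangentSpace 𝓘(ℝ, E) x) : TangentSpace 𝓘(ℝ, F) (φ x) :=
  pullbackConn φ (fun x' ↦ mfderiv 𝓘(ℝ, E) 𝓘(ℝ, F) φ x' (coordField w x')) x v
    - mfderiv 𝓘(ℝ, E) 𝓘(ℝ, F) φ x (leviCivita (coordField w) x v)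

variable (E F) in
/-- The tension field `τ(φ) = Tr(∇dφ)`. -/
def tension (φ : M → N) (x : M) : TangentSpace 𝓘(ℝ, F) (φ x) :=
  let e := stdOrthonormalBasis ℝ (TangentSpace 𝓘(ℝ, E) x)
  ∑ i, nablaDiff φ x (e i) (e i)

variable (E F) in
/-- The `p`-tension field `τ_p(φ) = ‖dφ‖^(p-2) (τ(φ) + (p-2) dφ(∇ ln ‖dφ‖))`. -/
def pTension (p : ℝ) (φ : M → N) (x : M) : TangentSpace 𝓘(ℝ, F) (φ x) :=
  (diffNorm E F φ x ^ (p - 2)) • (tension E F φ x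
    + (p - 2) • mfderiv 𝓘(ℝ, E) 𝓘(ℝ, F) φ x
        (grad (fun x' ↦ Real.log (diffNorm E F φ x')) x))

variable (E F) in
/-- `φ` is a smooth submersion. -/
def IsSubmersive (φ : M → N) : Prop :=
  ContMDiff 𝓘(ℝ, E) 𝓘(ℝ, F) ∞ φ ∧
    ∀ x, Function.Surjective (mfderiv 𝓘(ℝ, E) 𝓘(ℝ, F) φ x)

variable (E F) in
/-- The numbers `μ i`, `i < dim N`, are, with multiplicities, non-zero eigenvalues of the first
fundamental form `φ^*h` at `x` with respect to `g`, with `g`-orthonormal eigenvectors. For a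
submersion `φ^*h` has rank `dim N`, so these are all its non-zero eigenvalues. -/
def AreNonzeroEigenvalues (φ : M → N) (x : M) (μ : Fin (Module.finrank ℝ F) → ℝ) : Prop :=
  ∃ e : Fin (Module.finrank ℝ F) → TangentSpace 𝓘(ℝ, E) x, Orthonormal ℝ e ∧ ∀ i, μ i ≠ 0 ∧
    ∀ w : TangentSpace 𝓘(ℝ, E) x,
      inner ℝ (mfderiv 𝓘(ℝ, E) 𝓘(ℝ, F) φ x (e i)) (mfderiv 𝓘(ℝ, E) 𝓘(ℝ, F) φ x w)
        = μ i * inner ℝ (e i) w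

variable (E F) in
/-- The submersion `φ` is (weakly) horizontally conformal to first order at `x`: the non-zero
eigenvalues `μ 1, …, μ n` of `φ^*h` near `x`, suitably enumerated, are differentiable at `x`,
and have the same value and the same differential (equivalently, the same gradient) at `x`. -/
def HorizontallyConformalToFirstOrderAt (φ : M → N) (x : M) : Prop :=
  ∃ μ : Fin (Module.finrank ℝ F) → M → ℝ,
    (∀ᶠ x' in 𝓝 x, AreNonzeroEigenvalues E F φ x' (fun i ↦ μ i x')) ∧
    (∀ i, MDifferentiableAt 𝓘(ℝ, E) 𝓘(ℝ) (μ i) x) ∧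
    ∀ i j, μ i x = μ j x ∧ grad (E := E) (μ i) x = grad (E := E) (μ j) x

end Tension

section Submanifold

variable (F : Type*) [NormedAddCommGroup F] [NormedSpace ℝ F]
  {N : Type*} [TopologicalSpace N] [ChartedSpace F N] [IsManifold 𝓘(ℝ, F) ∞ N]

/-- `B ⊆ N` is a smooth (embedded) submanifold of codimension `p`: near each of its points it is the
zero set of a smooth submersion to `ℝ^p`. -/
def IsSubmanifold (p : ℕ) (B : Set N) : Prop :=
  ∀ y ∈ B, ∃ (U : Set N) (f : N → EuclideanSpace ℝ (Fin p)), IsOpen U ∧ y ∈ U ∧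
    ContMDiffOn 𝓘(ℝ, F) 𝓘(ℝ, EuclideanSpace ℝ (Fin p)) ∞ f U ∧
    (∀ z ∈ U, z ∈ B ↔ f z = 0) ∧ ∀ z ∈ U, Function.Surjective (mvfderiv 𝓘(ℝ, F) f z)

/-- The tangent space `T_yB ⊆ T_yN` of a submanifold `B` at `y ∈ B`: the vectors annihilated by the
differentials of all smooth function germs at `y` that vanish on `B`. -/
def tangentTo (B : Set N) (y : N) : Submodule ℝ (TangentSpace 𝓘(ℝ, F) y) where
  carrier := {v | ∀ f : N → ℝ, ContMDiffAt 𝓘(ℝ, F) 𝓘(ℝ) ∞ f y → (∀ᶠ z in 𝓝[B] y, f z = 0) →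
    mvfderiv 𝓘(ℝ, F) f y v = 0}
  add_mem' := fun {v w} hv hw f hf hB ↦ by rw [map_add, hv f hf hB, hw f hf hB, add_zero]
  zero_mem' := fun f _ _ ↦ map_zero _
  smul_mem' := fun c v hv f hf hB ↦ by rw [map_smul, hv f hf hB, smul_zero]

/-- `Y` is a vector field, smooth at `y` and with value `w` at `y`, that is tangent to `B` at all
points of `B` near `y`. -/
def IsTangentExtension (B : Set N) (y : N) (w : TangentSpace 𝓘(ℝ, F) y)
    (Y : Π z : N, TangentSpace 𝓘(ℝ, F) z) : Prop :=
  ContMDiffAt 𝓘(ℝ, F) (𝓘(ℝ, F).prod 𝓘(ℝ, F)) ∞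
      (fun z ↦ (⟨z, Y z⟩ : Bundle.TotalSpace F (TangentSpace 𝓘(ℝ, F) : N → Type _))) y ∧
    Y y = w ∧ ∀ᶠ z in 𝓝[B] y, Y z ∈ tangentTo F B z

variable [FiniteDimensional ℝ F] [RiemannianBundle (fun y : N ↦ TangentSpace 𝓘(ℝ, F) y)]

/-- The second fundamental form `II(v, w) = (∇_v Y)^⊥` of the submanifold `B` at `y ∈ B`, for
`v, w ∈ T_yB`, where `Y` is a vector field tangent to `B` that extends `w`. Such a `Y` exists, and
the value does not depend on which one is chosen. -/
def secondFundamentalForm (B : Set N) (y : N) (v w : TangentSpace 𝓘(ℝ, F) y) :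
    TangentSpace 𝓘(ℝ, F) y :=
  (tangentTo F B y)ᗮ.starProjection
    (leviCivita (Classical.epsilon (IsTangentExtension F B y w)) y v)

/-- The mean curvature vector of the submanifold `B` at `y ∈ B`: the trace of its second
fundamental form over `T_yB`. -/
def meanCurvature (B : Set N) (y : N) : TangentSpace 𝓘(ℝ, F) y :=
  let b := stdOrthonormalBasis ℝ (tangentTo F B y)
  ∑ i, secondFundamentalForm F B y (b i : TangentSpace 𝓘(ℝ, F) y) (b i)

/-- `B` is a minimal submanifold of codimension `p`: a submanifold of codimension `p` whose mean
curvature vanishes identically. -/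
def IsMinimalSubmanifold (p : ℕ) (B : Set N) : Prop :=
  IsSubmanifold F p B ∧ ∀ y ∈ B, meanCurvature F B y = 0

end Submanifold

end RiemGeom

end

noncomputable section

set_option linter.unusedSectionVars false

/-! Near a point of `B` write `B` as the zero set of a submersion `f`; then `φ⁻¹(B)` is locally the
zero set of `f ∘ φ`. Differentiating `df(Y) = 0` along `B` for a tangent field `Y` shows `df(II(v,
w)) = -Hess f(v, w)`. Since `df` is injective on normal vectors, minimality at a point means that
the trace of `Hess f` over the tangent space vanishes (`IsZeroSetOn.meanCurvature_eq_zero_iff`).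

The chain rule `Hess(f ∘ φ)(v, w) = Hess f(dφ v, dφ w) + df(∇dφ(v, w))` (`hessian_comp`) is traced
over `K = dφ⁻¹(TB)`, the tangent space of `φ⁻¹(B)`. Let `λ` be the common eigenvalue at `x` and `G`
the common gradient. Conformality at the point turns the first term into `λ` times the trace of
`Hess f` over `TB`. For the second, the trace of `∇dφ` over `K` is `τ(φ)` minus the trace over the
`p`-dimensional horizontal space `Kᗮ`. There, for horizontal `v` and `z`, `⟨∇dφ(v, v), dφ z⟩ = ⟨G,
v⟩⟨v, z⟩ - ½⟨G, z⟩⟨v, v⟩` (`inner_nablaDiff_of_conformal`). As `df` kills `TB` and `∇ ln‖dφ‖ = G /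
(2λ)`, what remains is `‖dφ‖^(2-p) df(τ_p(φ))`. Hence (`sum_hessian_comp_of_conformal`) `tr_K Hess(f
∘ φ) = λ tr_TB Hess f + ‖dφ‖^(2-p) df(τ_p(φ))`, with both coefficients positive. The three terms
correspond to (iii), (ii) and (i), so any two vanishing forces the third to vanish.

The analytic point is that the eigenvectors are not assumed even continuous, so the identity for
`∇dφ` cannot be obtained by differentiating an eigenframe. Instead `φ^*h` and `λg` are compared on a
vector with constant chart coefficients that is horizontal at `x`. Nearby its vertical part is of
first order in the distance and enters quadratically, while the spread of the eigenvalues is of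
smaller than first order. So the two forms have equal derivatives at `x` on horizontal vectors
(`abs_sub_le_of_eigenvectors`, `hasFDerivAt_sub_pullbackRep`), and Koszul's formula needs nothing
more. -/

namespace RiemGeom

/-! ### Tangent vectors, differentials and the metric in a preferred chart -/

section Chart

variable {E : Type*} [NormedAddCommGroup E] [NormedSpace ℝ E]
  {M : Type*} [TopologicalSpace M] [ChartedSpace E M] [IsManifold 𝓘(ℝ, E) ∞ M]
  {V : Type*} [NormedAddCommGroup V] [NormedSpace ℝ V]

/-- The isomorphism `T_zM → E` given by the preferred chart at `x`. -/
def toModel (x z : M) : TangentSpace 𝓘(ℝ, E) z →L[ℝ] E :=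
  (trivializationAt E (TangentSpace 𝓘(ℝ, E) : M → Type _) x).continuousLinearMapAt ℝ z

/-- The isomorphism `E → T_zM` given by the preferred chart at `x`. -/
def ofModel (x z : M) : E →L[ℝ] TangentSpace 𝓘(ℝ, E) z :=
  (trivializationAt E (TangentSpace 𝓘(ℝ, E) : M → Type _) x).symmL ℝ z

lemma ofModel_toModel {x z : M} (hz : z ∈ (chartAt E x).source) (v : TangentSpace 𝓘(ℝ, E) z) :
    ofModel x z (toModel x z v) = v :=
  (trivializationAt E (TangentSpace 𝓘(ℝ, E) : M → Type _) x).symmL_continuousLinearMapAt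
    (by simpa using hz) v

lemma toModel_ofModel {x z : M} (hz : z ∈ (chartAt E x).source) (v : E) :
    toModel x z (ofModel x z v) = v :=
  (trivializationAt E (TangentSpace 𝓘(ℝ, E) : M → Type _) x).continuousLinearMapAt_symmL
    (by simpa using hz) v

@[simp] lemma ofModel_toModel_self {x : M} (v : TangentSpace 𝓘(ℝ, E) x) :
    ofModel x x (toModel x x v) = v := ofModel_toModel (mem_chart_source E x) v

@[simp] lemma toModel_ofModel_self {x : M} (v : E) :
    toModel x x (ofModel x x v) = v := toModel_ofModel (mem_chart_source E x) v

lemma coords_eq_toModel {x z : M} (hz : z ∈ (chartAt E x).source) (v : TangentSpace 𝓘(ℝ, E) z) :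
    coords x v = toModel x z v := by
  rw [toModel, coords, Trivialization.continuousLinearMapAt_apply,
    Trivialization.coe_linearMapAt_of_mem _ (by simpa using hz)]

lemma ofCoords_eq_ofModel (x : M) (v : E) : ofCoords x v = ofModel x x v := rfl

lemma ofModel_apply {x z : M} (hz : z ∈ (chartAt E x).source) (v : E) :
    ofModel x z v = (trivializationAt E (TangentSpace 𝓘(ℝ, E) : M → Type _) x).symm z v := by
  rw [ofModel, Trivialization.symmL_apply]
  simpa using hz

lemma coordField_eq_ofModel {x z : M} (hz : z ∈ (chartAt E x).source)
    (v : TangentSpace 𝓘(ℝ, E) x) : coordField v z = ofModel x z (toModel x x v) := by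
  rw [← coords_eq_toModel (mem_chart_source E x), ofModel_apply hz]
  rfl

@[simp] lemma coordField_self {x : M} (v : TangentSpace 𝓘(ℝ, E) x) : coordField v x = v :=
  FiberBundle.extend_apply_self E v

lemma toModel_eq_mfderiv {x z : M} (hz : z ∈ (chartAt E x).source) :
    toModel x z = mfderiv 𝓘(ℝ, E) 𝓘(ℝ, E) (extChartAt 𝓘(ℝ, E) x) z :=
  have : IsManifold 𝓘(ℝ, E) 1 M := .of_le (n := ∞) (by simp)
  TangentBundle.continuousLinearMapAt_trivializationAt hz

lemma mvfderiv_ofModel {x z : M} (hz : z ∈ (chartAt E x).source) {f : M → V}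
    (hf : MDifferentiableAt 𝓘(ℝ, E) 𝓘(ℝ, V) f z) (v : E) :
    mvfderiv 𝓘(ℝ, E) f z (ofModel x z v) =
      fderiv ℝ (f ∘ (extChartAt 𝓘(ℝ, E) x).symm) (extChartAt 𝓘(ℝ, E) x z) v := by
  have : IsManifold 𝓘(ℝ, E) 1 M := .of_le (n := ∞) (by simp)
  have hz' : (extChartAt 𝓘(ℝ, E) x).symm (extChartAt 𝓘(ℝ, E) x z) = z :=
    (extChartAt 𝓘(ℝ, E) x).left_inv (by simpa using hz)
  have hs : MDifferentiableAt 𝓘(ℝ, E) 𝓘(ℝ, E) (extChartAt 𝓘(ℝ, E) x).symm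
      (extChartAt 𝓘(ℝ, E) x z) := by
    have := mdifferentiableWithinAt_extChartAt_symm (I := 𝓘(ℝ, E)) (x := x)
      (z := extChartAt 𝓘(ℝ, E) x z) ((extChartAt 𝓘(ℝ, E) x).map_source (by simpa using hz))
    rwa [ModelWithCorners.range_eq_univ, mdifferentiableWithinAt_univ] at this
  have h := TangentBundle.symmL_trivializationAt (I := 𝓘(ℝ, E)) hz
  rw [ModelWithCorners.range_eq_univ, mfderivWithin_univ] at h
  have h' : ofModel x z v = mfderiv 𝓘(ℝ, E) 𝓘(ℝ, E) (extChartAt 𝓘(ℝ, E) x).symm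
      (extChartAt 𝓘(ℝ, E) x z) v := DFunLike.congr_fun h v
  -- The chart followed by its inverse returns `z` only propositionally, so the base point of the
  -- differential is changed by substitution.
  have h3 : ∀ z', z' = z → ∀ w : E, mfderiv 𝓘(ℝ, E) 𝓘(ℝ, V) f z w =
      (mfderiv 𝓘(ℝ, E) 𝓘(ℝ, V) f z' w : V) := by
    rintro z' rfl w
    rfl
  rw [← mfderiv_eq_fderiv, mfderiv_comp_of_eq (by rwa [hz']) hs rfl, h']
  exact h3 _ hz' _

lemma mvfderiv_eq_fderiv {x : M} {f : M → V}
    (hf : MDifferentiableAt 𝓘(ℝ, E) 𝓘(ℝ, V) f x) (v : TangentSpace 𝓘(ℝ, E) x) :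
    mvfderiv 𝓘(ℝ, E) f x v =
      fderiv ℝ (f ∘ (extChartAt 𝓘(ℝ, E) x).symm) (extChartAt 𝓘(ℝ, E) x x) (toModel x x v) := by
  rw [← mvfderiv_ofModel (mem_chart_source E x) hf, ofModel_toModel_self]

/-- A function that is given in the chart at `x` by `g`. -/
lemma mvfderiv_comp_chart {x : M} {g : E → V} {f : M → V}
    (hg : DifferentiableAt ℝ g (extChartAt 𝓘(ℝ, E) x x))
    (hfg : ∀ᶠ z in 𝓝 x, f z = g (extChartAt 𝓘(ℝ, E) x z)) (v : TangentSpace 𝓘(ℝ, E) x) :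
    mvfderiv 𝓘(ℝ, E) f x v = fderiv ℝ g (extChartAt 𝓘(ℝ, E) x x) (toModel x x v) := by
  have : IsManifold 𝓘(ℝ, E) 1 M := .of_le (n := ∞) (by simp)
  have h1 : MDifferentiableAt 𝓘(ℝ, E) 𝓘(ℝ, E) (extChartAt 𝓘(ℝ, E) x) x :=
    mdifferentiableAt_extChartAt (mem_chart_source E x)
  have h2 : mfderiv 𝓘(ℝ, E) 𝓘(ℝ, V) f x =
      mfderiv 𝓘(ℝ, E) 𝓘(ℝ, V) (g ∘ extChartAt 𝓘(ℝ, E) x) x :=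
    Filter.EventuallyEq.mfderiv_eq hfg
  rw [mfderiv_comp x hg.mdifferentiableAt h1, mfderiv_eq_fderiv] at h2
  rw [toModel_eq_mfderiv (mem_chart_source E x)]
  exact DFunLike.congr_fun h2 v

lemma contDiffAt_comp_chart_symm {x : M} {f : M → V} {n : ℕ∞ω}
    (hf : ContMDiffAt 𝓘(ℝ, E) 𝓘(ℝ, V) n f x) :
    ContDiffAt ℝ n (f ∘ (extChartAt 𝓘(ℝ, E) x).symm) (extChartAt 𝓘(ℝ, E) x x) := by
  have := (contMDiffAt_iff.1 hf).2
  rw [ModelWithCorners.range_eq_univ, contDiffWithinAt_univ] at this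
  exact this

lemma differentiableAt_comp_chart_symm {x : M} {f : M → V}
    (hf : MDifferentiableAt 𝓘(ℝ, E) 𝓘(ℝ, V) f x) :
    DifferentiableAt ℝ (f ∘ (extChartAt 𝓘(ℝ, E) x).symm) (extChartAt 𝓘(ℝ, E) x x) := by
  have := (mdifferentiableAt_iff _ _).1 hf
  rw [ModelWithCorners.range_eq_univ, differentiableWithinAt_univ] at this
  exact this.2

lemma eventually_chart_symm {x : M} {P : M → Prop} (h : ∀ᶠ z in 𝓝 x, P z) :
    ∀ᶠ u in 𝓝 (extChartAt 𝓘(ℝ, E) x x), P ((extChartAt 𝓘(ℝ, E) x).symm u) := by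
  have := (continuousAt_extChartAt_symm (I := 𝓘(ℝ, E)) x).tendsto
  rw [extChartAt_to_inv] at this
  exact this.eventually h

lemma eventually_mem_chart_source (x : M) : ∀ᶠ z in 𝓝 x, z ∈ (chartAt E x).source :=
  (chartAt E x).open_source.mem_nhds (mem_chart_source E x)

lemma eventually_chart_right_inv (x : M) : ∀ᶠ u in 𝓝 (extChartAt 𝓘(ℝ, E) x x),
    extChartAt 𝓘(ℝ, E) x ((extChartAt 𝓘(ℝ, E) x).symm u) = u := by
  filter_upwards [extChartAt_target_mem_nhds (I := 𝓘(ℝ, E)) x] with u hu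
  exact (extChartAt 𝓘(ℝ, E) x).right_inv hu

variable [RiemannianBundle (fun x : M ↦ TangentSpace 𝓘(ℝ, E) x)]

/-- The metric of `M` in the preferred chart at `x`. -/
def metricRep (x : M) (u : E) : E →L[ℝ] E →L[ℝ] ℝ :=
  letI z := (extChartAt 𝓘(ℝ, E) x).symm u
  (innerSL ℝ (E := TangentSpace 𝓘(ℝ, E) z)).bilinearComp (ofModel x z) (ofModel x z)

lemma metricRep_apply (x : M) (u v w : E) : metricRep x u v w =
    inner ℝ (ofModel x ((extChartAt 𝓘(ℝ, E) x).symm u) v)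
      (ofModel x ((extChartAt 𝓘(ℝ, E) x).symm u) w) := rfl

lemma metricRep_chart {x z : M} (hz : z ∈ (chartAt E x).source) (v w : E) :
    metricRep x (extChartAt 𝓘(ℝ, E) x z) v w = inner ℝ (ofModel x z v) (ofModel x z w) := by
  rw [metricRep_apply, (extChartAt 𝓘(ℝ, E) x).left_inv (by simpa using hz)]

lemma metricRep_comm (x : M) (u v w : E) : metricRep x u v w = metricRep x u w v := by
  rw [metricRep_apply, metricRep_apply, real_inner_comm]

lemma metricRep_self {x : M} (v w : TangentSpace 𝓘(ℝ, E) x) :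
    metricRep x (extChartAt 𝓘(ℝ, E) x x) (toModel x x v) (toModel x x w) = inner ℝ v w := by
  rw [metricRep_chart (mem_chart_source E x), ofModel_toModel_self, ofModel_toModel_self]

/-- The smooth section of the bundle of bilinear forms that witnesses smoothness of the metric has,
in the trivialization at `x`, exactly `metricRep x` as its coordinates near `x`. -/
lemma contDiffAt_metricRep
    [IsContMDiffRiemannianBundle 𝓘(ℝ, E) ∞ E (fun x : M ↦ TangentSpace 𝓘(ℝ, E) x)] (x : M) :
    ContDiffAt ℝ ∞ (metricRep x) (extChartAt 𝓘(ℝ, E) x x) := by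
  obtain ⟨g, hg, hin⟩ := ‹IsContMDiffRiemannianBundle 𝓘(ℝ, E) ∞ E
    (fun x : M ↦ TangentSpace 𝓘(ℝ, E) x)›.exists_contMDiff
  have h1 := ((contMDiffAt_hom_bundle _).1 (hg x)).2
  refine (contDiffAt_comp_chart_symm h1).congr_of_eventuallyEq ?_
  filter_upwards [eventually_chart_symm (eventually_mem_chart_source (E := E) x)] with u hu
  ext v w
  have hb : (extChartAt 𝓘(ℝ, E) x).symm u ∈
      (trivializationAt E (TangentSpace 𝓘(ℝ, E) : M → Type _) x).baseSet := by simpa using hu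
  simp only [Function.comp_apply]
  rw [inCoordinates_apply_eq₂ hb hb (Set.mem_univ _), metricRep_apply, hin, ofModel_apply hu,
    ofModel_apply hu]
  simp

end Chart

/-! ### Derivatives of pulled-back bilinear forms and the Koszul combination -/

section Calculus

variable {E : Type*} [NormedAddCommGroup E] [NormedSpace ℝ E]
  {F : Type*} [NormedAddCommGroup F] [NormedSpace ℝ F]

/-- A shortcut instance. -/
instance bilinNormedAddCommGroup {E F G : Type*} [NormedAddCommGroup E] [NormedSpace ℝ E]
    [NormedAddCommGroup F] [NormedSpace ℝ F] [NormedAddCommGroup G] [NormedSpace ℝ G] :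
    NormedAddCommGroup (E →L[ℝ] F →L[ℝ] G) :=
  ContinuousLinearMap.toNormedAddCommGroup

lemma differentiableAt_clm_apply_apply {b : E → F →L[ℝ] F →L[ℝ] ℝ} {u : E}
    (hb : DifferentiableAt ℝ b u) (v w : F) : DifferentiableAt ℝ (fun u ↦ b u v w) u := by
  fun_prop

lemma differentiableAt_clm_apply_const {b : E → F →L[ℝ] ℝ} {u : E}
    (hb : DifferentiableAt ℝ b u) (v : F) : DifferentiableAt ℝ (fun u ↦ b u v) u := by
  fun_prop

lemma fderiv_clm_apply_apply {b : E → F →L[ℝ] F →L[ℝ] ℝ} {u : E}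
    (hb : DifferentiableAt ℝ b u) (v w : F) (c : E) :
    fderiv ℝ (fun u ↦ b u v w) u c = fderiv ℝ b u c v w := by
  rw [fderiv_clm_apply (by fun_prop) (by fun_prop), fderiv_clm_apply hb (by fun_prop)]
  simp

variable {g : F → F →L[ℝ] F →L[ℝ] ℝ} {f : E → F} {u : E}

lemma differentiableAt_pullback (hg : DifferentiableAt ℝ g (f u)) (hf : DifferentiableAt ℝ f u)
    (hd : DifferentiableAt ℝ (fderiv ℝ f) u) (a : E) :
    DifferentiableAt ℝ (fun u ↦ (g (f u)).bilinearComp (fderiv ℝ f u) (fderiv ℝ f u) a) u := by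
  have h0 : DifferentiableAt ℝ (fun u ↦ g (f u)) u := DifferentiableAt.comp (g := g) u hg hf
  have h1 : DifferentiableAt ℝ (fun u ↦ fderiv ℝ f u a) u := by fun_prop
  exact (h0.clm_apply h1).clm_comp hd

lemma fderiv_pullback (hg : DifferentiableAt ℝ g (f u)) (hf : DifferentiableAt ℝ f u)
    (hd : DifferentiableAt ℝ (fderiv ℝ f) u) (a b c : E) :
    fderiv ℝ (fun u ↦ (g (f u)).bilinearComp (fderiv ℝ f u) (fderiv ℝ f u) a b) u c =
      fderiv ℝ g (f u) (fderiv ℝ f u c) (fderiv ℝ f u a) (fderiv ℝ f u b)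
      + g (f u) (fderiv ℝ (fderiv ℝ f) u c a) (fderiv ℝ f u b)
      + g (f u) (fderiv ℝ f u a) (fderiv ℝ (fderiv ℝ f) u c b) := by
  have h0 : DifferentiableAt ℝ (fun u ↦ g (f u)) u := DifferentiableAt.comp (g := g) u hg hf
  have h1 : fderiv ℝ (fun u ↦ g (f u)) u = (fderiv ℝ g (f u)).comp (fderiv ℝ f u) :=
    fderiv_comp (g := g) u hg hf
  have h2 : ∀ a, DifferentiableAt ℝ (fun u ↦ fderiv ℝ f u a) u := by fun_prop
  have h3 : ∀ a, fderiv ℝ (fun u ↦ fderiv ℝ f u a) u c = fderiv ℝ (fderiv ℝ f) u c a := by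
    intro a
    rw [fderiv_clm_apply hd (by fun_prop)]
    simp
  simp only [ContinuousLinearMap.bilinearComp_apply]
  rw [fderiv_clm_apply (h0.clm_apply (h2 a)) (h2 b), fderiv_clm_apply h0 (h2 a), h1]
  simp [h3]
  ring

/-- The combination of first derivatives occurring in Koszul's formula. -/
def koszulForm (D : F → F → F → ℝ) (a b c : F) : ℝ :=
  (1 / 2) * (D a b c + D b a c - D c a b)

lemma koszulForm_sum_smul (D : F →L[ℝ] F →L[ℝ] F →L[ℝ] ℝ) (a b : F) {ι : Type*} [Fintype ι]
    (r : ι → ℝ) (c : ι → F) :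
    koszulForm (fun a b c ↦ D a b c) a b (∑ i, r i • c i) =
      ∑ i, r i * koszulForm (fun a b c ↦ D a b c) a b (c i) := by
  simp only [koszulForm, map_sum, map_smul, sum_apply, smul_apply, smul_eq_mul]
  rw [← Finset.sum_add_distrib, ← Finset.sum_sub_distrib, Finset.mul_sum]
  exact Finset.sum_congr rfl fun i _ ↦ by ring

end Calculus

/-! ### Christoffel symbols in terms of the chart metric -/

section Christoffel

variable {F : Type*} [NormedAddCommGroup F] [NormedSpace ℝ F] [FiniteDimensional ℝ F]
  {N : Type*} [TopologicalSpace N] [ChartedSpace F N] [IsManifold 𝓘(ℝ, F) ∞ N]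
  [RiemannianBundle (fun y : N ↦ TangentSpace 𝓘(ℝ, F) y)]
  [IsContMDiffRiemannianBundle 𝓘(ℝ, F) ∞ F (fun y : N ↦ TangentSpace 𝓘(ℝ, F) y)]

lemma differentiableAt_metricRep (y : N) :
    DifferentiableAt ℝ (metricRep y) (extChartAt 𝓘(ℝ, F) y y) :=
  (contDiffAt_metricRep y).differentiableAt (by simp)

lemma mvfderiv_metricCoeff {y : N} (v w z : TangentSpace 𝓘(ℝ, F) y) :
    mvfderiv 𝓘(ℝ, F) (metricCoeff v w) y z =
      fderiv ℝ (metricRep y) (extChartAt 𝓘(ℝ, F) y y) (toModel y y z) (toModel y y v)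
        (toModel y y w) := by
  have hd := differentiableAt_metricRep (F := F) y
  rw [mvfderiv_comp_chart (g := fun u ↦ metricRep y u (toModel y y v) (toModel y y w))]
  · exact fderiv_clm_apply_apply hd _ _ _
  · exact differentiableAt_clm_apply_apply hd _ _
  · filter_upwards [eventually_mem_chart_source (E := F) y] with z hz
    rw [metricRep_chart hz, metricCoeff, coordField_eq_ofModel hz, coordField_eq_ofModel hz]

lemma koszul_eq_koszulForm {y : N} (v w z : TangentSpace 𝓘(ℝ, F) y) :
    koszul v w z = koszulForm (fun a b c ↦ fderiv ℝ (metricRep y) (extChartAt 𝓘(ℝ, F) y y) a b c)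
      (toModel y y v) (toModel y y w) (toModel y y z) := by
  simp only [koszul, mvfderiv_metricCoeff, koszulForm]

lemma inner_christoffel {y : N} (v w z : TangentSpace 𝓘(ℝ, F) y) :
    inner ℝ (christoffel v w) z = koszul v w z := by
  conv_rhs => rw [← (stdOrthonormalBasis ℝ (TangentSpace 𝓘(ℝ, F) y)).sum_repr z]
  simp only [koszul_eq_koszulForm, map_sum, map_smul, koszulForm_sum_smul, christoffel, sum_inner,
    inner_smul_left, OrthonormalBasis.repr_apply_apply, conj_trivial]
  refine Finset.sum_congr rfl fun i _ ↦ by rw [mul_comm, real_inner_comm]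

end Christoffel

/-! ### Coordinate form and Koszul formula for `∇dφ` -/

section Map

variable {E : Type*} [NormedAddCommGroup E] [NormedSpace ℝ E] [FiniteDimensional ℝ E]
  {F : Type*} [NormedAddCommGroup F] [NormedSpace ℝ F] [FiniteDimensional ℝ F]
  {M : Type*} [TopologicalSpace M] [ChartedSpace E M] [IsManifold 𝓘(ℝ, E) ∞ M]
  {N : Type*} [TopologicalSpace N] [ChartedSpace F N] [IsManifold 𝓘(ℝ, F) ∞ N]
  {φ : M → N}

variable (E F) in
/-- The map `φ` in the preferred charts at `x` and `φ x`. -/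
def mapRep (φ : M → N) (x : M) : E → F :=
  extChartAt 𝓘(ℝ, F) (φ x) ∘ φ ∘ (extChartAt 𝓘(ℝ, E) x).symm

lemma mapRep_self (φ : M → N) (x : M) :
    mapRep E F φ x (extChartAt 𝓘(ℝ, E) x x) = extChartAt 𝓘(ℝ, F) (φ x) (φ x) := by
  simp [mapRep]

lemma mapRep_chart {x z : M} (hz : z ∈ (chartAt E x).source) :
    mapRep E F φ x (extChartAt 𝓘(ℝ, E) x z) = extChartAt 𝓘(ℝ, F) (φ x) (φ z) := by
  rw [mapRep, Function.comp_apply, Function.comp_apply,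
    (extChartAt 𝓘(ℝ, E) x).left_inv (by simpa using hz)]

lemma contDiffAt_mapRep {x : M} (hφ : ContMDiffAt 𝓘(ℝ, E) 𝓘(ℝ, F) ∞ φ x) :
    ContDiffAt ℝ ∞ (mapRep E F φ x) (extChartAt 𝓘(ℝ, E) x x) := by
  have := (contMDiffAt_iff.1 hφ).2
  rw [ModelWithCorners.range_eq_univ, contDiffWithinAt_univ] at this
  exact this

lemma differentiableAt_fderiv_mapRep {x : M} (hφ : ContMDiffAt 𝓘(ℝ, E) 𝓘(ℝ, F) ∞ φ x) :
    DifferentiableAt ℝ (fderiv ℝ (mapRep E F φ x)) (extChartAt 𝓘(ℝ, E) x x) :=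
  ((contDiffAt_mapRep hφ).fderiv_right (m := 1) (by norm_cast)).differentiableAt (by simp)

lemma toModel_mfderiv_ofModel {x z : M} (hz : z ∈ (chartAt E x).source)
    (hz' : φ z ∈ (chartAt F (φ x)).source) (hφ : MDifferentiableAt 𝓘(ℝ, E) 𝓘(ℝ, F) φ z) (v : E) :
    toModel (φ x) (φ z) (mfderiv 𝓘(ℝ, E) 𝓘(ℝ, F) φ z (ofModel x z v)) =
      fderiv ℝ (mapRep E F φ x) (extChartAt 𝓘(ℝ, E) x z) v := by
  have : IsManifold 𝓘(ℝ, F) 1 N := .of_le (n := ∞) (by simp)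
  have h1 : MDifferentiableAt 𝓘(ℝ, F) 𝓘(ℝ, F) (extChartAt 𝓘(ℝ, F) (φ x)) (φ z) :=
    mdifferentiableAt_extChartAt hz'
  have h2 := mvfderiv_ofModel hz (h1.comp z hφ) v
  rw [mvfderiv, mfderiv_comp z h1 hφ] at h2
  rw [toModel_eq_mfderiv hz']
  exact h2

lemma mfderiv_ofModel {x z : M} (hz : z ∈ (chartAt E x).source)
    (hz' : φ z ∈ (chartAt F (φ x)).source) (hφ : MDifferentiableAt 𝓘(ℝ, E) 𝓘(ℝ, F) φ z) (v : E) :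
    mfderiv 𝓘(ℝ, E) 𝓘(ℝ, F) φ z (ofModel x z v) =
      ofModel (φ x) (φ z) (fderiv ℝ (mapRep E F φ x) (extChartAt 𝓘(ℝ, E) x z) v) := by
  rw [← toModel_mfderiv_ofModel hz hz' hφ, ofModel_toModel hz']

lemma toModel_mfderiv {x : M} (hφ : MDifferentiableAt 𝓘(ℝ, E) 𝓘(ℝ, F) φ x)
    (v : TangentSpace 𝓘(ℝ, E) x) :
    toModel (φ x) (φ x) (mfderiv 𝓘(ℝ, E) 𝓘(ℝ, F) φ x v) =
      fderiv ℝ (mapRep E F φ x) (extChartAt 𝓘(ℝ, E) x x) (toModel x x v) := by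
  rw [← toModel_mfderiv_ofModel (mem_chart_source E x) (mem_chart_source F (φ x)) hφ,
    ofModel_toModel_self]

variable (hφ : ContMDiff 𝓘(ℝ, E) 𝓘(ℝ, F) ∞ φ)

include hφ

lemma eventually_map_mem_chart_source (x : M) :
    ∀ᶠ z in 𝓝 x, φ z ∈ (chartAt F (φ x)).source :=
  hφ.continuous.continuousAt.eventually (eventually_mem_chart_source (φ x))

variable [RiemannianBundle (fun x : M ↦ TangentSpace 𝓘(ℝ, E) x)]
  [RiemannianBundle (fun y : N ↦ TangentSpace 𝓘(ℝ, F) y)]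

/-- A coordinate field has constant components, so its covariant derivative is a Christoffel term
alone, and differentiating its image under `dφ` leaves only the second derivative of the chart
expression of `φ`. -/
lemma nablaDiff_eq (x : M) (v w : TangentSpace 𝓘(ℝ, E) x) :
    nablaDiff φ x v w =
      ofModel (φ x) (φ x) (fderiv ℝ (fderiv ℝ (mapRep E F φ x)) (extChartAt 𝓘(ℝ, E) x x)
        (toModel x x v) (toModel x x w))
      + christoffel (mfderiv 𝓘(ℝ, E) 𝓘(ℝ, F) φ x v) (mfderiv 𝓘(ℝ, E) 𝓘(ℝ, F) φ x w)
      - mfderiv 𝓘(ℝ, E) 𝓘(ℝ, F) φ x (christoffel v w) := by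
  have hd := differentiableAt_fderiv_mapRep (hφ x)
  have h1 : mvfderiv 𝓘(ℝ, E) (fun z ↦ coords x (coordField w z)) x v = 0 := by
    rw [mvfderiv_comp_chart (g := fun _ ↦ toModel x x w) (by fun_prop)]
    · simp
    · filter_upwards [eventually_mem_chart_source (E := E) x] with z hz
      rw [coords_eq_toModel hz, coordField_eq_ofModel hz, toModel_ofModel hz]
  have h2 : mvfderiv 𝓘(ℝ, E) (fun z ↦ coords (φ x)
      (mfderiv 𝓘(ℝ, E) 𝓘(ℝ, F) φ z (coordField w z))) x v =
      fderiv ℝ (fderiv ℝ (mapRep E F φ x)) (extChartAt 𝓘(ℝ, E) x x)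
        (toModel x x v) (toModel x x w) := by
    rw [mvfderiv_comp_chart (g := fun u ↦ fderiv ℝ (mapRep E F φ x) u (toModel x x w))
      (by fun_prop)]
    · rw [fderiv_clm_apply hd (by fun_prop)]
      simp
    · filter_upwards [eventually_mem_chart_source (E := E) x,
        eventually_map_mem_chart_source hφ x] with z hz hz'
      rw [coords_eq_toModel hz', coordField_eq_ofModel hz, toModel_mfderiv_ofModel hz hz'
        (hφ.mdifferentiableAt (by simp))]
  rw [nablaDiff, pullbackConn, leviCivita, h1, h2, ofCoords_eq_ofModel, ofCoords_eq_ofModel,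
    map_zero, zero_add, coordField_self]

omit hφ in
variable (E F φ) in
/-- The first fundamental form `φ^*h` in the preferred chart at `x`. -/
def pullbackRep (x : M) (u : E) : E →L[ℝ] E →L[ℝ] ℝ :=
  (metricRep (φ x) (mapRep E F φ x u)).bilinearComp (fderiv ℝ (mapRep E F φ x) u)
    (fderiv ℝ (mapRep E F φ x) u)

omit hφ in
lemma pullbackRep_comm (x : M) (u a b : E) :
    pullbackRep E F φ x u a b = pullbackRep E F φ x u b a :=
  metricRep_comm (φ x) (mapRep E F φ x u) (fderiv ℝ (mapRep E F φ x) u a)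
    (fderiv ℝ (mapRep E F φ x) u b)

lemma pullbackRep_chart {x z : M} (hz : z ∈ (chartAt E x).source)
    (hz' : φ z ∈ (chartAt F (φ x)).source) (v w : E) :
    pullbackRep E F φ x (extChartAt 𝓘(ℝ, E) x z) v w =
      inner ℝ (mfderiv 𝓘(ℝ, E) 𝓘(ℝ, F) φ z (ofModel x z v))
        (mfderiv 𝓘(ℝ, E) 𝓘(ℝ, F) φ z (ofModel x z w)) := by
  rw [mfderiv_ofModel hz hz' (hφ.mdifferentiableAt (by simp)),
    mfderiv_ofModel hz hz' (hφ.mdifferentiableAt (by simp)), ← metricRep_chart hz',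
    ← mapRep_chart hz]
  rfl

lemma pullbackRep_self {x : M} (v w : TangentSpace 𝓘(ℝ, E) x) :
    pullbackRep E F φ x (extChartAt 𝓘(ℝ, E) x x) (toModel x x v) (toModel x x w) =
      inner ℝ (mfderiv 𝓘(ℝ, E) 𝓘(ℝ, F) φ x v) (mfderiv 𝓘(ℝ, E) 𝓘(ℝ, F) φ x w) := by
  rw [pullbackRep_chart hφ (mem_chart_source E x) (mem_chart_source F (φ x)),
    ofModel_toModel_self, ofModel_toModel_self]

variable [IsContMDiffRiemannianBundle 𝓘(ℝ, E) ∞ E (fun x : M ↦ TangentSpace 𝓘(ℝ, E) x)]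
  [IsContMDiffRiemannianBundle 𝓘(ℝ, F) ∞ F (fun y : N ↦ TangentSpace 𝓘(ℝ, F) y)]

lemma differentiableAt_metricRep_mapRep (x : M) :
    DifferentiableAt ℝ (metricRep (φ x)) (mapRep E F φ x (extChartAt 𝓘(ℝ, E) x x)) := by
  rw [mapRep_self]
  exact differentiableAt_metricRep (φ x)

lemma differentiableAt_pullbackRep (x : M) (a : E) :
    DifferentiableAt ℝ (fun u ↦ pullbackRep E F φ x u a) (extChartAt 𝓘(ℝ, E) x x) :=
  differentiableAt_pullback (differentiableAt_metricRep_mapRep hφ x)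
    ((contDiffAt_mapRep (hφ x)).differentiableAt (by simp)) (differentiableAt_fderiv_mapRep (hφ x)) a

lemma fderiv_pullbackRep (x : M) (a b c : E) :
    fderiv ℝ (fun u ↦ pullbackRep E F φ x u a b) (extChartAt 𝓘(ℝ, E) x x) c =
      fderiv ℝ (metricRep (φ x)) (extChartAt 𝓘(ℝ, F) (φ x) (φ x))
        (fderiv ℝ (mapRep E F φ x) (extChartAt 𝓘(ℝ, E) x x) c)
        (fderiv ℝ (mapRep E F φ x) (extChartAt 𝓘(ℝ, E) x x) a)
        (fderiv ℝ (mapRep E F φ x) (extChartAt 𝓘(ℝ, E) x x) b)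
      + metricRep (φ x) (extChartAt 𝓘(ℝ, F) (φ x) (φ x))
        (fderiv ℝ (fderiv ℝ (mapRep E F φ x)) (extChartAt 𝓘(ℝ, E) x x) c a)
        (fderiv ℝ (mapRep E F φ x) (extChartAt 𝓘(ℝ, E) x x) b)
      + metricRep (φ x) (extChartAt 𝓘(ℝ, F) (φ x) (φ x))
        (fderiv ℝ (mapRep E F φ x) (extChartAt 𝓘(ℝ, E) x x) a)
        (fderiv ℝ (fderiv ℝ (mapRep E F φ x)) (extChartAt 𝓘(ℝ, E) x x) c b) := by
  rw [← mapRep_self (E := E) (F := F) φ x]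
  exact fderiv_pullback (differentiableAt_metricRep_mapRep hφ x)
    ((contDiffAt_mapRep (hφ x)).differentiableAt (by simp))
    (differentiableAt_fderiv_mapRep (hφ x)) a b c

/-- The product rule gives six terms with second derivatives of the chart map. By symmetry of the
second derivative and of the metric, four of them cancel and the other two agree, which absorbs the
factor `1 / 2`. -/
lemma koszulForm_pullbackRep (x : M) (a b c : E) :
    koszulForm (fun c a b ↦ fderiv ℝ (fun u ↦ pullbackRep E F φ x u a b) (extChartAt 𝓘(ℝ, E) x x) c)
        a b c =
      koszulForm
        (fun a b c ↦ fderiv ℝ (metricRep (φ x)) (extChartAt 𝓘(ℝ, F) (φ x) (φ x)) a b c)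
        (fderiv ℝ (mapRep E F φ x) (extChartAt 𝓘(ℝ, E) x x) a)
        (fderiv ℝ (mapRep E F φ x) (extChartAt 𝓘(ℝ, E) x x) b)
        (fderiv ℝ (mapRep E F φ x) (extChartAt 𝓘(ℝ, E) x x) c)
      + metricRep (φ x) (extChartAt 𝓘(ℝ, F) (φ x) (φ x))
        (fderiv ℝ (fderiv ℝ (mapRep E F φ x)) (extChartAt 𝓘(ℝ, E) x x) a b)
        (fderiv ℝ (mapRep E F φ x) (extChartAt 𝓘(ℝ, E) x x) c) := by
  have hs : IsSymmSndFDerivAt ℝ (mapRep E F φ x) (extChartAt 𝓘(ℝ, E) x x) :=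
    (contDiffAt_mapRep (hφ x)).isSymmSndFDerivAt (by simp; norm_cast)
  simp only [koszulForm, fderiv_pullbackRep hφ]
  rw [hs b a, hs c a, hs c b, metricRep_comm _ _ (fderiv ℝ (mapRep E F φ x) _ b)
    (fderiv ℝ (fderiv ℝ (mapRep E F φ x)) _ a c)]
  ring

/-- Koszul's formula for the second fundamental form of a map. -/
lemma inner_nablaDiff (x : M) (v w z : TangentSpace 𝓘(ℝ, E) x) :
    inner ℝ (nablaDiff φ x v w) (mfderiv 𝓘(ℝ, E) 𝓘(ℝ, F) φ x z) =
      koszulForm (fun c a b ↦ fderiv ℝ (fun u ↦ pullbackRep E F φ x u a b) (extChartAt 𝓘(ℝ, E) x x) c)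
        (toModel x x v) (toModel x x w) (toModel x x z)
      - inner ℝ (mfderiv 𝓘(ℝ, E) 𝓘(ℝ, F) φ x (christoffel v w))
        (mfderiv 𝓘(ℝ, E) 𝓘(ℝ, F) φ x z) := by
  have hd : MDifferentiableAt 𝓘(ℝ, E) 𝓘(ℝ, F) φ x := hφ.mdifferentiableAt (by simp)
  rw [nablaDiff_eq hφ, inner_sub_left, inner_add_left, inner_christoffel, koszul_eq_koszulForm,
    koszulForm_pullbackRep hφ, ← metricRep_self, toModel_ofModel_self, toModel_mfderiv hd,
    toModel_mfderiv hd, toModel_mfderiv hd]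
  ring

end Map

/-! ### Traces, eigenvectors and horizontally conformal linear maps -/

section LinearAlgebra

variable {V : Type*} [NormedAddCommGroup V] [InnerProductSpace ℝ V] [FiniteDimensional ℝ V]
  {W : Type*} [NormedAddCommGroup W] [InnerProductSpace ℝ W] [FiniteDimensional ℝ W]
  {U : Type*} [AddCommGroup U] [Module ℝ U]
  {ι κ : Type*} [Fintype ι] [Fintype κ]

/-- The trace of a bilinear map pulled back by a linear map that is conformal on its horizontal
space. -/
lemma sum_bilin_comp_eq_smul_sum {A : V →ₗ[ℝ] W} {A' : W → V} {r : ℝ}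
    (hA' : ∀ v w, inner ℝ (A v) w = inner ℝ v (A' w)) (hr : ∀ w, A (A' w) = r • w)
    (b : W →ₗ[ℝ] W →ₗ[ℝ] U) (e : OrthonormalBasis ι ℝ V) (f : OrthonormalBasis κ ℝ W) :
    ∑ i, b (A (e i)) (A (e i)) = r • ∑ j, b (f j) (f j) := by
  classical
  have h1 : ∀ i, b (A (e i)) (A (e i)) =
      ∑ j, ∑ k, (inner ℝ (A' (f j)) (e i) * inner ℝ (e i) (A' (f k))) • b (f j) (f k) := by
    intro i
    conv_lhs => rw [← f.sum_repr (A (e i))]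
    simp only [map_sum, map_smul, LinearMap.sum_apply, LinearMap.smul_apply,
      OrthonormalBasis.repr_apply_apply, Finset.smul_sum, smul_smul, mul_comm]
    rw [Finset.sum_comm]
    refine Finset.sum_congr rfl fun j _ ↦ Finset.sum_congr rfl fun k _ ↦ ?_
    rw [← real_inner_comm (f k), hA', ← real_inner_comm (f j), hA',
      ← real_inner_comm (e i) (A' (f j)), mul_comm]
  simp only [h1]
  rw [Finset.sum_comm, Finset.smul_sum]
  refine Finset.sum_congr rfl fun j _ ↦ ?_
  rw [Finset.sum_comm]
  have h2 : ∀ k, ∑ i, (inner ℝ (A' (f j)) (e i) * inner ℝ (e i) (A' (f k))) • b (f j) (f k) =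
      (if j = k then r else 0) • b (f j) (f k) := by
    intro k
    rw [← Finset.sum_smul, e.sum_inner_mul_inner, ← hA', hr, real_inner_smul_left,
      f.inner_eq_ite]
    simp
  simp [h2]

/-- Inserting the projection to `K` expresses the trace over `K` through a basis of `V`. Traces over
`K` and `Kᗮ` then add up because the two projections sum to the identity. -/
lemma sum_bilin_subspace {K : Submodule ℝ V} (b : V →ₗ[ℝ] V →ₗ[ℝ] U)
    (e : OrthonormalBasis ι ℝ V) (c : OrthonormalBasis κ ℝ K) :
    ∑ j, b (c j) (c j) = ∑ i, b (e i) (K.starProjection (e i)) := by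
  have h1 : ∀ i, K.starProjection (e i) = ∑ j, inner ℝ (c j : V) (e i) • (c j : V) := by
    intro i
    rw [Submodule.starProjection_apply, c.orthogonalProjectionOnto_apply_eq_sum]
    simp
  simp only [h1, map_sum, map_smul]
  rw [Finset.sum_comm]
  refine Finset.sum_congr rfl fun j _ ↦ ?_
  conv_lhs => enter [1]; rw [← e.sum_repr (c j)]
  simp [OrthonormalBasis.repr_apply_apply, real_inner_comm]

lemma sum_bilin_add_sum_orthogonal {K : Submodule ℝ V} {κ' : Type*} [Fintype κ']
    (b : V →ₗ[ℝ] V →ₗ[ℝ] U) (e : OrthonormalBasis ι ℝ V) (c : OrthonormalBasis κ ℝ K)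
    (d : OrthonormalBasis κ' ℝ Kᗮ) :
    ∑ i, b (e i) (e i) = ∑ j, b (c j) (c j) + ∑ j, b (d j) (d j) := by
  rw [sum_bilin_subspace b e c, sum_bilin_subspace b e d, ← Finset.sum_add_distrib]
  refine Finset.sum_congr rfl fun i _ ↦ ?_
  rw [← map_add, Submodule.starProjection_add_starProjection_orthogonal]

section Eigen

variable {A : V →ₗ[ℝ] W} {n : ℕ} (hn : Module.finrank ℝ W = n) {e : Fin n → V} (he : Orthonormal ℝ e)
  {μ : Fin n → ℝ} (hμ : ∀ i, μ i ≠ 0)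
  (heig : ∀ i w, inner ℝ (A (e i)) (A w) = μ i * inner ℝ (e i) w)

omit [FiniteDimensional ℝ V] [FiniteDimensional ℝ W] in
include he in
lemma inner_sub_sum_eigenvectors (a : V) (i) :
    inner ℝ (e i) (a - ∑ j, inner ℝ (e j) a • e j) = 0 := by
  rw [inner_sub_right, he.inner_right_fintype, sub_self]

include he hμ heig

omit [FiniteDimensional ℝ V] [FiniteDimensional ℝ W] in
lemma eigenvalue_pos (i) : 0 < μ i := by
  have h := heig i (e i)
  rw [real_inner_self_eq_norm_sq, real_inner_self_eq_norm_sq, he.1 i] at h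
  exact lt_of_le_of_ne (by nlinarith [sq_nonneg ‖A (e i)‖]) (hμ i).symm

include hn

-- The images `A (e i)` are nonzero and pairwise orthogonal, and there are `dim W` of them, so they
-- span `W`; `A w` is orthogonal to each one.
omit [FiniteDimensional ℝ V] in
lemma map_eq_zero_of_orthogonal_eigenvectors {w : V}
    (hw : ∀ i, inner ℝ (e i) w = 0) : A w = 0 := by
  have hne : ∀ i, A (e i) ≠ 0 := by
    intro i h0
    have h := heig i (e i)
    rw [h0, inner_zero_left, real_inner_self_eq_norm_sq, he.1 i] at h
    exact hμ i (by linarith)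
  have hli : LinearIndependent ℝ (fun i ↦ A (e i)) := by
    refine linearIndependent_of_ne_zero_of_inner_eq_zero hne fun i j hij ↦ ?_
    change inner ℝ (A (e i)) (A (e j)) = 0
    rw [heig, he.2 hij, mul_zero]
  have hspan := hli.span_eq_top_of_card_eq_finrank' (by simp [hn])
  have hmem : A w ∈ (Submodule.span ℝ (Set.range fun i ↦ A (e i)))ᗮ := by
    rw [Submodule.mem_orthogonal]
    intro u hu
    induction hu using Submodule.span_induction with
    | mem x hx =>
      obtain ⟨i, rfl⟩ := hx
      simp only [heig, hw i, mul_zero]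
    | zero => simp
    | add x y _ _ hx hy => rw [inner_add_left, hx, hy, add_zero]
    | smul a x _ hx => rw [inner_smul_left, hx, mul_zero]
  rw [hspan, Submodule.top_orthogonal_eq_bot] at hmem
  simpa using hmem

omit [FiniteDimensional ℝ V] in
lemma map_sub_sum_eigenvectors (a : V) : A (a - ∑ j, inner ℝ (e j) a • e j) = 0 :=
  map_eq_zero_of_orthogonal_eigenvectors hn he hμ heig (inner_sub_sum_eigenvectors he a)

omit [FiniteDimensional ℝ V] in
lemma inner_map_map_eq_sum (a b : V) :
    inner ℝ (A a) (A b) = ∑ i, μ i * (inner ℝ (e i) a * inner ℝ (e i) b) := by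
  have h := map_sub_sum_eigenvectors hn he hμ heig a
  rw [map_sub, sub_eq_zero] at h
  rw [h]
  simp only [map_sum, map_smul, sum_inner, real_inner_smul_left, heig]
  exact Finset.sum_congr rfl fun i _ ↦ by ring

omit [FiniteDimensional ℝ V] in
lemma sum_norm_sq_map (f : OrthonormalBasis ι ℝ V) : ∑ k, ‖A (f k)‖ ^ 2 = ∑ i, μ i := by
  simp only [← real_inner_self_eq_norm_sq, inner_map_map_eq_sum hn he hμ heig]
  rw [Finset.sum_comm]
  refine Finset.sum_congr rfl fun i _ ↦ ?_
  rw [← Finset.mul_sum]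
  have : ∑ k, inner ℝ (e i) (f k) * inner ℝ (e i) (f k) = 1 := by
    simp_rw [← fun k ↦ real_inner_comm (e i) (f k)]
    have := f.sum_inner_mul_inner (e i) (e i)
    rw [real_inner_self_eq_norm_sq, he.1 i] at this
    simp_rw [← fun k ↦ real_inner_comm (e i) (f k)] at this
    simpa using this
  rw [this, mul_one]

-- The difference of the two sides is orthogonal to every `e j` and lies in the kernel of `A`, to
-- which `z` is orthogonal; hence it is orthogonal to itself.
omit [FiniteDimensional ℝ V] in
lemma eq_sum_eigenvectors_of_mem_orthogonal_ker {z : V} (hz : z ∈ (LinearMap.ker A)ᗮ) :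
    z = ∑ j, inner ℝ (e j) z • e j := by
  rw [← sub_eq_zero, ← inner_self_eq_zero (𝕜 := ℝ)]
  nth_rw 1 [inner_sub_left]
  rw [sum_inner]
  simp only [inner_smul_left, inner_sub_sum_eigenvectors he, mul_zero,
    Finset.sum_const_zero, sub_zero]
  exact Submodule.inner_left_of_mem_orthogonal
    (LinearMap.mem_ker.2 (map_sub_sum_eigenvectors hn he hμ heig z)) hz

omit [FiniteDimensional ℝ V] in
lemma inner_map_map_of_mem_orthogonal_ker {r : ℝ} (hr : ∀ i, μ i = r) {z : V}
    (hz : z ∈ (LinearMap.ker A)ᗮ) (w : V) : inner ℝ (A z) (A w) = r * inner ℝ z w := by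
  rw [eq_sum_eigenvectors_of_mem_orthogonal_ker hn he hμ heig hz]
  simp only [map_sum, map_smul, sum_inner, real_inner_smul_left, heig, hr, Finset.mul_sum]
  exact Finset.sum_congr rfl fun i _ ↦ by ring

end Eigen

section Conformal

variable {A : V →ₗ[ℝ] W} (hA : Function.Surjective A) {r : ℝ} (hr : r ≠ 0)
  (hconf : ∀ z ∈ (LinearMap.ker A)ᗮ, ∀ w, inner ℝ (A z) (A w) = r * inner ℝ z w)

include hA

omit [FiniteDimensional ℝ W] in
lemma exists_horizontal_lift (w : W) : ∃ z ∈ (LinearMap.ker A)ᗮ, A z = w := by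
  obtain ⟨v, rfl⟩ := hA w
  refine ⟨v - (LinearMap.ker A).starProjection v,
    Submodule.sub_starProjection_mem_orthogonal v, ?_⟩
  rw [map_sub, sub_eq_self]
  exact LinearMap.mem_ker.1 (Submodule.starProjection_apply_mem _ v)

include hconf

lemma map_adjoint_of_conformal (w : W) : A (LinearMap.adjoint A w) = r • w := by
  have hmem : LinearMap.adjoint A w ∈ (LinearMap.ker A)ᗮ := by
    rw [Submodule.mem_orthogonal]
    intro k hk
    rw [LinearMap.adjoint_inner_right, LinearMap.mem_ker.1 hk, inner_zero_left]
  refine ext_inner_right ℝ fun u ↦ ?_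
  obtain ⟨v, rfl⟩ := hA u
  rw [hconf _ hmem, LinearMap.adjoint_inner_left, real_inner_smul_left]

/-- Since `A A* = r`, the adjoint maps `S` into its preimage. Thus `A` restricts to a map from the
preimage to `S` whose adjoint is the restricted adjoint, and the trace formula applies to this
restriction. -/
lemma sum_bilin_comap_eq_smul_sum (S : Submodule ℝ W) (b : W →ₗ[ℝ] W →ₗ[ℝ] U)
    (c : OrthonormalBasis ι ℝ (S.comap A)) (d : OrthonormalBasis κ ℝ S) :
    ∑ i, b (A (c i)) (A (c i)) = r • ∑ j, b (d j) (d j) := by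
  have hm : ∀ w : S, LinearMap.adjoint A w ∈ S.comap A := by
    intro w
    rw [Submodule.mem_comap, map_adjoint_of_conformal hA hconf]
    exact S.smul_mem _ w.2
  have hrestr : ∀ v ∈ S.comap A, A v ∈ S := fun v hv ↦ hv
  exact sum_bilin_comp_eq_smul_sum (A := A.restrict hrestr) (A' := fun w ↦ ⟨_, hm w⟩) (r := r)
    (fun v w ↦ (LinearMap.adjoint_inner_right A v w).symm)
    (fun w ↦ Subtype.ext (map_adjoint_of_conformal hA hconf w))
    (b.compl₁₂ S.subtype S.subtype) c d

include hr

/-- The trace of the second fundamental form of a map that is horizontally conformal to first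
order, over the preimage of a subspace. -/
lemma sum_comap_eq_of_conformal {S : Submodule ℝ W} {θ : W →ₗ[ℝ] U} (hθ : ∀ w ∈ S, θ w = 0)
    {G : V} {β : V →ₗ[ℝ] V →ₗ[ℝ] W}
    (hβ : ∀ x ∈ (LinearMap.ker A)ᗮ, ∀ z ∈ (LinearMap.ker A)ᗮ,
      inner ℝ (β x x) (A z) = inner ℝ G x * inner ℝ x z - (1 / 2) * (inner ℝ G z * inner ℝ x x))
    {p : ℕ} (hp : Module.finrank ℝ ((S.comap A)ᗮ : Submodule ℝ V) = p)
    (e : OrthonormalBasis ι ℝ V) (c : OrthonormalBasis κ ℝ (S.comap A)) :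
    ∑ j, θ (β (c j) (c j)) = θ (∑ i, β (e i) (e i) + ((p : ℝ) - 2) • A ((2 * r)⁻¹ • G)) := by
  set d := stdOrthonormalBasis ℝ ((S.comap A)ᗮ : Submodule ℝ V)
  have hle : (S.comap A)ᗮ ≤ (LinearMap.ker A)ᗮ :=
    Submodule.orthogonal_le fun k hk ↦ by
      rw [Submodule.mem_comap, LinearMap.mem_ker.1 hk]
      exact S.zero_mem
  -- Every vector of `W` is the image of a horizontal `z`, so `hβ` determines `β x x` completely;
  -- conformality rewrites inner products with `z` as inner products with `A z`, at the cost of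
  -- `r⁻¹`.
  have h1 : ∀ x ∈ (S.comap A)ᗮ, β x x =
      r⁻¹ • (inner ℝ x G • A x - (1 / 2 * inner ℝ x x : ℝ) • A G) := by
    intro x hx
    refine ext_inner_right ℝ fun u ↦ ?_
    obtain ⟨z, hz, rfl⟩ := exists_horizontal_lift hA u
    rw [hβ x (hle hx) z hz, real_inner_smul_left, inner_sub_left, real_inner_smul_left,
      real_inner_smul_left, hconf x (hle hx), real_inner_comm (A z) (A G), hconf z hz,
      real_inner_comm x G, real_inner_comm z G]
    field_simp
  have h2 : ∑ j, β (d j) (d j) = r⁻¹ • (A ((S.comap A)ᗮ.starProjection G)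
      - ((p : ℝ) / 2) • A G) := by
    rw [Submodule.starProjection_apply, d.orthogonalProjectionOnto_apply_eq_sum]
    have : ∀ j, β (d j) (d j) = r⁻¹ • (inner ℝ (d j : V) G • A (d j) - (1 / 2 : ℝ) • A G) := by
      intro j
      rw [h1 _ (d j).2]
      have : inner ℝ (d j : V) (d j) = 1 := by
        have := d.orthonormal.1 j
        rw [real_inner_self_eq_norm_sq]
        rw [Submodule.coe_norm] at this
        rw [this]
        norm_num
      rw [this, mul_one]
    simp only [this, ← Finset.smul_sum, Finset.sum_sub_distrib]
    congr 2
    · simp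
    · rw [Finset.sum_const, Finset.card_univ, Fintype.card_fin, hp, ← Nat.cast_smul_eq_nsmul ℝ,
        smul_smul]
      congr 1
      ring
  -- The discarded component of `G` lies in the preimage of `S`, so its image lies in `S`, where `θ`
  -- vanishes.
  have h3 : θ (A ((S.comap A)ᗮ.starProjection G)) = θ (A G) := by
    rw [← sub_eq_zero, ← map_sub, ← map_sub]
    apply hθ
    rw [← Submodule.mem_comap, ← neg_mem_iff, neg_sub,
      Submodule.starProjection_orthogonal']
    simp
  have h4 := sum_bilin_add_sum_orthogonal β e c d
  rw [← map_sum, ← sub_eq_zero, ← map_sub]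
  -- The trace over the preimage is the full trace minus the one over the complement. By `h2` and
  -- `h3` the latter contributes `-r⁻¹ (1 - p/2) = (p - 2) / (2r)` times `θ (A G)`, which is the
  -- source of the factor `p - 2`.
  have h5 : ∑ j, β (c j) (c j) - (∑ i, β (e i) (e i) + ((p : ℝ) - 2) • A ((2 * r)⁻¹ • G)) =
      - ∑ j, β (d j) (d j) - ((p : ℝ) - 2) • A ((2 * r)⁻¹ • G) := by
    rw [h4]; abel
  rw [h5, h2]
  simp only [map_sub, map_neg, map_smul, h3]
  match_scalars
  field_simp
  ring

end Conformal

end LinearAlgebra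

/-! ### Quantitative deviation from horizontal conformality -/

section EigenvalueEstimate

variable {V : Type*} [NormedAddCommGroup V] [InnerProductSpace ℝ V]
  {W : Type*} [NormedAddCommGroup W] [InnerProductSpace ℝ W] [FiniteDimensional ℝ W]

/-- The failure of `A` to be horizontally conformal with dilation `r`, estimated at a vector `a`
which is almost horizontal. -/
lemma abs_sub_le_of_eigenvectors {A : V →ₗ[ℝ] W} {n : ℕ} (hn : Module.finrank ℝ W = n)
    {e : Fin n → V}
    (he : Orthonormal ℝ e) {μ : Fin n → ℝ} (hμ : ∀ i, μ i ≠ 0)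
    (heig : ∀ i w, inner ℝ (A (e i)) (A w) = μ i * inner ℝ (e i) w) {r D : ℝ} (hr : 0 < r) (hD0 : 0 ≤ D)
    {a : V} (hD : ∀ k, |r * inner ℝ a k - inner ℝ (A a) (A k)| ≤ D * ‖k‖) :
    |r * inner ℝ a a - inner ℝ (A a) (A a)| ≤ (∑ i, |r - μ i|) * inner ℝ a a + D ^ 2 / r := by
  set w := a - ∑ j, inner ℝ (e j) a • e j with hw
  have hAw : A w = 0 := map_sub_sum_eigenvectors hn he hμ heig a
  have hew : ∀ i, inner ℝ (e i) w = 0 := inner_sub_sum_eigenvectors he a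
  have hsum : ∀ b, inner ℝ a b = ∑ i, inner ℝ (e i) a * inner ℝ (e i) b + inner ℝ w b := by
    intro b
    have : a = ∑ j, inner ℝ (e j) a • e j + w := by rw [hw]; abel
    conv_lhs => rw [this]
    simp only [inner_add_left, sum_inner, real_inner_smul_left]
  have haw : inner ℝ a w = ‖w‖ ^ 2 := by
    rw [hsum w, real_inner_self_eq_norm_sq]
    simp [hew]
  have hwa : inner ℝ w a = ‖w‖ ^ 2 := by rw [real_inner_comm, haw]
  -- The hypothesis is tested on the vertical part `w` of `a` itself: `A w = 0` and `⟨a, w⟩ = ‖w‖²`.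
  -- So `D` controls `w` linearly, and its contribution `r‖w‖²` is quadratic in `D`.
  have h1 : r * ‖w‖ ≤ D := by
    rcases (norm_nonneg w).eq_or_lt with h0 | h0
    · rwa [← h0, mul_zero]
    · have := hD w
      rw [hAw, inner_zero_right, sub_zero, haw, abs_of_nonneg (by positivity)] at this
      nlinarith
  have h2 : r * ‖w‖ ^ 2 ≤ D ^ 2 / r := by
    rw [le_div_iff₀ hr]
    nlinarith [mul_nonneg hr.le (norm_nonneg w)]
  have h3 : r * inner ℝ a a - inner ℝ (A a) (A a) =
      ∑ i, (r - μ i) * inner ℝ (e i) a ^ 2 + r * ‖w‖ ^ 2 := by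
    rw [inner_map_map_eq_sum hn he hμ heig, hsum a, hwa, mul_add, Finset.mul_sum, add_sub_right_comm,
      ← Finset.sum_sub_distrib]
    congr 1
    exact Finset.sum_congr rfl fun i _ ↦ by ring
  have h4 : ∀ i, inner ℝ (e i) a ^ 2 ≤ inner ℝ a a := by
    intro i
    have := abs_real_inner_le_norm (e i) a
    rw [he.1 i, one_mul] at this
    rw [real_inner_self_eq_norm_sq, ← sq_abs]
    gcongr
  rw [h3, Finset.sum_mul]
  refine (abs_add_le _ _).trans (add_le_add ?_ ?_)
  · refine (Finset.abs_sum_le_sum_abs _ _).trans (Finset.sum_le_sum fun i _ ↦ ?_)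
    rw [abs_mul, abs_of_nonneg (sq_nonneg (inner ℝ (e i) a))]
    exact mul_le_mul_of_nonneg_left (h4 i) (abs_nonneg _)
  · rwa [abs_of_nonneg (by positivity)]

end EigenvalueEstimate

/-! ### Consequences of first-order horizontal conformality -/

section Conformal

variable {E : Type*} [NormedAddCommGroup E] [NormedSpace ℝ E] [FiniteDimensional ℝ E]
  {F : Type*} [NormedAddCommGroup F] [NormedSpace ℝ F] [FiniteDimensional ℝ F]
  {M : Type*} [TopologicalSpace M] [ChartedSpace E M] [IsManifold 𝓘(ℝ, E) ∞ M]
  [RiemannianBundle (fun x : M ↦ TangentSpace 𝓘(ℝ, E) x)]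
  [IsContMDiffRiemannianBundle 𝓘(ℝ, E) ∞ E (fun x : M ↦ TangentSpace 𝓘(ℝ, E) x)]
  {N : Type*} [TopologicalSpace N] [ChartedSpace F N] [IsManifold 𝓘(ℝ, F) ∞ N]
  [RiemannianBundle (fun y : N ↦ TangentSpace 𝓘(ℝ, F) y)]
  [IsContMDiffRiemannianBundle 𝓘(ℝ, F) ∞ F (fun y : N ↦ TangentSpace 𝓘(ℝ, F) y)]
  {φ : M → N}

-- Converts operator-norm bounds in the fixed model space into bounds in the varying Riemannian
-- norms, uniformly near `x`.
omit [FiniteDimensional ℝ E] in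
lemma exists_norm_toModel_le (x : M) :
    ∃ C > 0, ∀ᶠ z in 𝓝 x, ∀ v : TangentSpace 𝓘(ℝ, E) z, ‖toModel x z v‖ ≤ C * ‖v‖ := by
  have : IsContinuousRiemannianBundle E (fun x : M ↦ TangentSpace 𝓘(ℝ, E) x) := by
    obtain ⟨g, hg, hin⟩ := ‹IsContMDiffRiemannianBundle 𝓘(ℝ, E) ∞ E
      (fun x : M ↦ TangentSpace 𝓘(ℝ, E) x)›.exists_contMDiff
    exact ⟨g, hg.continuous, hin⟩
  obtain ⟨C, hC, h⟩ := eventually_norm_trivializationAt_lt E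
    (fun x : M ↦ TangentSpace 𝓘(ℝ, E) x) x
  refine ⟨C, hC, ?_⟩
  filter_upwards [h] with z hz v
  exact ContinuousLinearMap.le_of_opNorm_le _ hz.le v

lemma inner_grad (f : M → ℝ) (x : M) (v : TangentSpace 𝓘(ℝ, E) x) :
    inner ℝ (grad f x) v = mvfderiv 𝓘(ℝ, E) f x v := by
  conv_rhs => rw [← (stdOrthonormalBasis ℝ (TangentSpace 𝓘(ℝ, E) x)).sum_repr v]
  simp only [grad, sum_inner, real_inner_smul_left, map_sum, map_smul, smul_eq_mul,
    OrthonormalBasis.repr_apply_apply]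
  exact Finset.sum_congr rfl fun i _ ↦ mul_comm _ _

variable (hφ : ContMDiff 𝓘(ℝ, E) 𝓘(ℝ, F) ∞ φ)

include hφ

variable {x : M} {μ : Fin (Module.finrank ℝ F) → M → ℝ}
  (hμ : ∀ᶠ x' in 𝓝 x, AreNonzeroEigenvalues E F φ x' (fun i ↦ μ i x'))
  (hd : ∀ i, MDifferentiableAt 𝓘(ℝ, E) 𝓘(ℝ) (μ i) x)
  (heq : ∀ i j, μ i x = μ j x ∧ grad (E := E) (μ i) x = grad (E := E) (μ j) x)

include hμ hd heq

omit hφ hμ in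
lemma fderiv_eigenvalue_eq (i j : Fin (Module.finrank ℝ F)) :
    fderiv ℝ (μ i ∘ (extChartAt 𝓘(ℝ, E) x).symm) (extChartAt 𝓘(ℝ, E) x x) =
      fderiv ℝ (μ j ∘ (extChartAt 𝓘(ℝ, E) x).symm) (extChartAt 𝓘(ℝ, E) x x) := by
  ext w
  rw [← mvfderiv_ofModel (mem_chart_source E x) (hd i),
    ← mvfderiv_ofModel (mem_chart_source E x) (hd j), ← inner_grad, ← inner_grad, (heq i j).2]

-- Two functions with equal value and equal derivative at a point differ there by `o` of the
-- distance. This is where equality of the eigenvalue gradients enters the estimate.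
omit hφ hμ in
lemma isLittleO_sub_eigenvalue (i j : Fin (Module.finrank ℝ F)) :
    (fun u ↦ |μ i ((extChartAt 𝓘(ℝ, E) x).symm u) - μ j ((extChartAt 𝓘(ℝ, E) x).symm u)|)
      =o[𝓝 (extChartAt 𝓘(ℝ, E) x x)] fun u ↦ u - extChartAt 𝓘(ℝ, E) x x := by
  have h := (differentiableAt_comp_chart_symm (hd i)).hasFDerivAt.sub
    (differentiableAt_comp_chart_symm (hd j)).hasFDerivAt
  rw [fderiv_eigenvalue_eq hd heq i j, sub_self, hasFDerivAt_iff_isLittleO] at h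
  simpa [(heq i j).1] using h.norm_left

omit hd in
lemma inner_mfderiv_mfderiv_of_mem_orthogonal (i₀ : Fin (Module.finrank ℝ F))
    {v : TangentSpace 𝓘(ℝ, E) x}
    (hv : v ∈ (LinearMap.ker (mfderiv 𝓘(ℝ, E) 𝓘(ℝ, F) φ x).toLinearMap)ᗮ)
    (w : TangentSpace 𝓘(ℝ, E) x) :
    inner ℝ (mfderiv 𝓘(ℝ, E) 𝓘(ℝ, F) φ x v) (mfderiv 𝓘(ℝ, E) 𝓘(ℝ, F) φ x w) =
      μ i₀ x * inner ℝ v w := by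
  obtain ⟨e, he, heig⟩ := hμ.self_of_nhds
  exact inner_map_map_of_mem_orthogonal_ker (A := (mfderiv 𝓘(ℝ, E) 𝓘(ℝ, F) φ x).toLinearMap)
    rfl he (fun i ↦ (heig i).1) (fun i ↦ (heig i).2) (fun i ↦ (heq i i₀).1) hv w

omit hφ hd heq in
lemma eventually_eigenvalue_pos : ∀ᶠ z in 𝓝 x, ∀ i, 0 < μ i z := by
  filter_upwards [hμ] with z ⟨e, he, heig⟩ i
  exact eigenvalue_pos (A := (mfderiv 𝓘(ℝ, E) 𝓘(ℝ, F) φ z).toLinearMap)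
    he (fun i ↦ (heig i).1) (fun i ↦ (heig i).2) i

/-- The first fundamental form of a map that is horizontally conformal to first order agrees, on
horizontal vectors, to first order with a multiple of the metric. -/
lemma hasFDerivAt_sub_pullbackRep (i₀ : Fin (Module.finrank ℝ F)) {v : TangentSpace 𝓘(ℝ, E) x}
    (hv : v ∈ (LinearMap.ker (mfderiv 𝓘(ℝ, E) 𝓘(ℝ, F) φ x).toLinearMap)ᗮ) :
    HasFDerivAt (fun u ↦ μ i₀ ((extChartAt 𝓘(ℝ, E) x).symm u) *
        metricRep x u (toModel x x v) (toModel x x v) -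
        pullbackRep E F φ x u (toModel x x v) (toModel x x v))
      (0 : E →L[ℝ] ℝ) (extChartAt 𝓘(ℝ, E) x x) := by
  set a := toModel x x v with ha
  set u₀ := extChartAt 𝓘(ℝ, E) x x with hu₀
  set r : E → ℝ := μ i₀ ∘ (extChartAt 𝓘(ℝ, E) x).symm with hr
  have hrd : DifferentiableAt ℝ r u₀ := differentiableAt_comp_chart_symm (hd i₀)
  have hr0 : r u₀ = μ i₀ x := by simp [hr, hu₀]
  have hrpos : 0 < r u₀ := hr0 ▸ (eventually_eigenvalue_pos (E := E) (F := F) hμ).self_of_nhds i₀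
  have hmd : DifferentiableAt ℝ (fun u ↦ metricRep x u a) u₀ := by
    have := differentiableAt_metricRep (F := E) x
    fun_prop
  -- One slot is filled by the constant vector `a` and the other left free. `L` vanishes at `u₀`
  -- because `v` is horizontal, and it is differentiable, so its norm is `O(‖u - u₀‖)`; this is the
  -- `D` of the eigenvector estimate.
  set L : E → E →L[ℝ] ℝ := fun u ↦ r u • metricRep x u a - pullbackRep E F φ x u a with hL
  have hLd : DifferentiableAt ℝ L u₀ := (hrd.smul hmd).sub (differentiableAt_pullbackRep hφ x a)
  have hL0 : L u₀ = 0 := by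
    ext w
    have h := inner_mfderiv_mfderiv_of_mem_orthogonal hφ hμ heq i₀ hv (ofModel x x w)
    rw [← pullbackRep_self hφ, ← metricRep_self, toModel_ofModel_self] at h
    simp only [hL, sub_apply, smul_apply, smul_eq_mul, zero_apply, hr0]
    rw [h, sub_self]
  obtain ⟨K, hK⟩ := hLd.isBigO_sub.bound
  obtain ⟨C, hC, hnorm⟩ := exists_norm_toModel_le (E := E) x
  have hbound : ∀ᶠ u in 𝓝 u₀, |r u * metricRep x u a a - pullbackRep E F φ x u a a| ≤
      (∑ i, |r u - μ i ((extChartAt 𝓘(ℝ, E) x).symm u)|) * metricRep x u a a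
        + ‖u - u₀‖ ^ 2 * ((|K| * C) ^ 2 / r u) := by
    filter_upwards [hK, eventually_chart_symm hnorm, eventually_chart_right_inv x,
      eventually_chart_symm (eventually_mem_chart_source (E := E) x),
      eventually_chart_symm (eventually_map_mem_chart_source hφ x),
      eventually_chart_symm (eventually_eigenvalue_pos (E := E) (F := F) hμ), eventually_chart_symm hμ] with
      u hKu hnu hcu hu hu' hpos ⟨e, he, heig⟩
    set z := (extChartAt 𝓘(ℝ, E) x).symm u with hz
    have hm : ∀ b c, metricRep x u b c = inner ℝ (ofModel x z b) (ofModel x z c) := by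
      intro b c
      rw [← metricRep_chart hu, hcu]
    have hp : ∀ b c, pullbackRep E F φ x u b c =
        inner ℝ (mfderiv 𝓘(ℝ, E) 𝓘(ℝ, F) φ z (ofModel x z b))
          (mfderiv 𝓘(ℝ, E) 𝓘(ℝ, F) φ z (ofModel x z c)) := by
      intro b c
      rw [← pullbackRep_chart hφ hu hu', hcu]
    rw [hL0, sub_zero] at hKu
    have hD : ∀ k, |r u * inner ℝ (ofModel x z a) k -
        inner ℝ (mfderiv 𝓘(ℝ, E) 𝓘(ℝ, F) φ z (ofModel x z a))
          (mfderiv 𝓘(ℝ, E) 𝓘(ℝ, F) φ z k)| ≤ (|K| * ‖u - u₀‖ * C) * ‖k‖ := by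
      intro k
      have h1 : L u (toModel x z k) = r u * inner ℝ (ofModel x z a) k -
          inner ℝ (mfderiv 𝓘(ℝ, E) 𝓘(ℝ, F) φ z (ofModel x z a))
            (mfderiv 𝓘(ℝ, E) 𝓘(ℝ, F) φ z k) := by
        simp only [hL, sub_apply, smul_apply, smul_eq_mul]
        rw [hm, hp, ofModel_toModel hu]
      rw [← h1, ← Real.norm_eq_abs]
      calc ‖L u (toModel x z k)‖ ≤ ‖L u‖ * ‖toModel x z k‖ := (L u).le_opNorm _
        _ ≤ (|K| * ‖u - u₀‖) * (C * ‖k‖) := by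
          gcongr
          · exact hKu.trans (by gcongr; exact le_abs_self K)
          · exact hnu k
        _ = _ := by ring
    have := abs_sub_le_of_eigenvectors (A := (mfderiv 𝓘(ℝ, E) 𝓘(ℝ, F) φ z).toLinearMap)
      rfl he (fun i ↦ (heig i).1) (fun i ↦ (heig i).2) (hpos i₀) (by positivity) hD
    rw [hm, hp]
    refine this.trans (le_of_eq ?_)
    congr 1
    simp only [hr, Function.comp_apply, ← hz]
    ring
  rw [hasFDerivAt_iff_isLittleO]
  have h0 : r u₀ * metricRep x u₀ a a - pullbackRep E F φ x u₀ a a = 0 := by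
    have := DFunLike.congr_fun hL0 a
    simpa [hL] using this
  have hmc : ContinuousAt (fun u ↦ metricRep x u a a) u₀ := by
    have := hmd.continuousAt
    fun_prop
  have hrc : ContinuousAt (fun u ↦ (|K| * C) ^ 2 / r u) u₀ :=
    continuousAt_const.div hrd.continuousAt hrpos.ne'
  have hlit1 : (fun u ↦ (∑ i, |r u - μ i ((extChartAt 𝓘(ℝ, E) x).symm u)|) * metricRep x u a a)
      =o[𝓝 u₀] fun u ↦ ‖u - u₀‖ := by
    have h1 : (fun u ↦ ∑ i, |r u - μ i ((extChartAt 𝓘(ℝ, E) x).symm u)|)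
        =o[𝓝 u₀] fun u ↦ ‖u - u₀‖ :=
      Asymptotics.IsLittleO.fun_sum fun i _ ↦ (isLittleO_sub_eigenvalue hd heq i₀ i).norm_right
    simpa using h1.mul_isBigO (hmc.tendsto.isBigO_one ℝ)
  have hlit2 : (fun u ↦ ‖u - u₀‖ ^ 2 * ((|K| * C) ^ 2 / r u)) =o[𝓝 u₀] fun u ↦ ‖u - u₀‖ := by
    have h1 := (Asymptotics.isLittleO_pow_sub_sub u₀ one_lt_two).norm_right
    simpa using h1.mul_isBigO (hrc.tendsto.isBigO_one ℝ)
  refine Asymptotics.IsBigO.trans_isLittleO ?_ (hlit1.add hlit2).of_norm_right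
  refine Asymptotics.IsBigO.of_bound 1 ?_
  filter_upwards [hbound] with u hu
  have h0' : μ i₀ ((extChartAt 𝓘(ℝ, E) x).symm u₀) * metricRep x u₀ a a
    - pullbackRep E F φ x u₀ a a = 0 := h0
  rw [h0', sub_zero, zero_apply, sub_zero, one_mul]
  exact hu.trans (le_abs_self _)

omit hμ hd heq in
lemma fderiv_pullbackRep_add (a b c : E) :
    fderiv ℝ (fun u ↦ pullbackRep E F φ x u (a + b) (a + b)) (extChartAt 𝓘(ℝ, E) x x) c =
      fderiv ℝ (fun u ↦ pullbackRep E F φ x u a a) (extChartAt 𝓘(ℝ, E) x x) c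
      + 2 * fderiv ℝ (fun u ↦ pullbackRep E F φ x u a b) (extChartAt 𝓘(ℝ, E) x x) c
      + fderiv ℝ (fun u ↦ pullbackRep E F φ x u b b) (extChartAt 𝓘(ℝ, E) x x) c := by
  have hP : ∀ a b, DifferentiableAt ℝ (fun u ↦ pullbackRep E F φ x u a b)
      (extChartAt 𝓘(ℝ, E) x x) := fun a b ↦
    differentiableAt_clm_apply_const (differentiableAt_pullbackRep hφ x a) b
  have h : (fun u ↦ pullbackRep E F φ x u (a + b) (a + b)) = fun u ↦
      pullbackRep E F φ x u a a + 2 * pullbackRep E F φ x u a b + pullbackRep E F φ x u b b := by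
    ext u
    have hc : pullbackRep E F φ x u b a = pullbackRep E F φ x u a b :=
      pullbackRep_comm x u b a
    simp only [map_add, add_apply, hc]
    ring
  have := hP a a
  have := hP a b
  have := hP b b
  rw [h, fderiv_fun_add (by fun_prop) (by fun_prop), fderiv_fun_add (by fun_prop) (by fun_prop),
    fderiv_const_mul (by fun_prop)]
  simp

omit hφ hμ hd heq in
lemma fderiv_metricRep_comm (a b c : E) :
    fderiv ℝ (metricRep x) (extChartAt 𝓘(ℝ, E) x x) c a b =
      fderiv ℝ (metricRep x) (extChartAt 𝓘(ℝ, E) x x) c b a := by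
  have hd := differentiableAt_metricRep (F := E) x
  rw [← fderiv_clm_apply_apply hd, ← fderiv_clm_apply_apply hd]
  simp only [metricRep_comm x _ a b]

/-- On horizontal `v` and `w`, `φ^*h` has the derivative of `λg`, with the product rule written out.
The diagonal case is `hasFDerivAt_sub_pullbackRep`, and polarization gives the rest; the direction
`z` of differentiation is arbitrary. -/
lemma fderiv_pullbackRep_of_conformal (i₀ : Fin (Module.finrank ℝ F))
    {v w : TangentSpace 𝓘(ℝ, E) x}
    (hv : v ∈ (LinearMap.ker (mfderiv 𝓘(ℝ, E) 𝓘(ℝ, F) φ x).toLinearMap)ᗮ)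
    (hw : w ∈ (LinearMap.ker (mfderiv 𝓘(ℝ, E) 𝓘(ℝ, F) φ x).toLinearMap)ᗮ)
    (z : TangentSpace 𝓘(ℝ, E) x) :
    fderiv ℝ (fun u ↦ pullbackRep E F φ x u (toModel x x v) (toModel x x w))
        (extChartAt 𝓘(ℝ, E) x x) (toModel x x z) =
      inner ℝ (grad (μ i₀) x) z * inner ℝ v w + μ i₀ x *
        fderiv ℝ (metricRep x) (extChartAt 𝓘(ℝ, E) x x) (toModel x x z) (toModel x x v)
          (toModel x x w) := by
  have hm := differentiableAt_metricRep (F := E) x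
  have hr : DifferentiableAt ℝ (fun u ↦ μ i₀ ((extChartAt 𝓘(ℝ, E) x).symm u))
    (extChartAt 𝓘(ℝ, E) x x) := differentiableAt_comp_chart_symm (hd i₀)
  have hdiag : ∀ v ∈ (LinearMap.ker (mfderiv 𝓘(ℝ, E) 𝓘(ℝ, F) φ x).toLinearMap)ᗮ,
      fderiv ℝ (fun u ↦ pullbackRep E F φ x u (toModel x x v) (toModel x x v))
        (extChartAt 𝓘(ℝ, E) x x) (toModel x x z) =
      inner ℝ (grad (μ i₀) x) z * inner ℝ v v + μ i₀ x *
        fderiv ℝ (metricRep x) (extChartAt 𝓘(ℝ, E) x x) (toModel x x z) (toModel x x v)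
          (toModel x x v) := by
    intro v hv
    have h := (hasFDerivAt_sub_pullbackRep hφ hμ hd heq i₀ hv).fderiv
    have hmv := differentiableAt_clm_apply_apply hm (toModel x x v) (toModel x x v)
    have hP : DifferentiableAt ℝ
        (fun u ↦ pullbackRep E F φ x u (toModel x x v) (toModel x x v))
        (extChartAt 𝓘(ℝ, E) x x) :=
      differentiableAt_clm_apply_const (differentiableAt_pullbackRep hφ x _) _
    rw [fderiv_fun_sub (hr.fun_mul hmv) hP, sub_eq_zero, fderiv_fun_mul hr hmv] at h
    rw [← h, inner_grad, mvfderiv_eq_fderiv (hd i₀), ← metricRep_self]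
    simp only [add_apply, smul_apply, smul_eq_mul, extChartAt_to_inv, fderiv_clm_apply_apply hm]
    rw [add_comm, mul_comm (metricRep x _ _ _)]
    rfl
  have h := fderiv_pullbackRep_add hφ (x := x) (toModel x x v) (toModel x x w) (toModel x x z)
  rw [← map_add, hdiag _ (add_mem hv hw), hdiag _ hv, hdiag _ hw] at h
  simp only [map_add, add_apply, inner_add_left, inner_add_right, real_inner_comm v w] at h
  rw [fderiv_metricRep_comm (toModel x x w) (toModel x x v)] at h
  linarith

/-- In Koszul's formula for `φ^*h` the derivatives of `g` reassemble to `λ⟨∇_v v, z⟩` in Christoffel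
form, which cancels `⟨dφ(∇_v v), dφ z⟩` because `z` is horizontal. Only derivatives of `λ` survive.
-/
lemma inner_nablaDiff_of_conformal (i₀ : Fin (Module.finrank ℝ F))
    {v z : TangentSpace 𝓘(ℝ, E) x}
    (hv : v ∈ (LinearMap.ker (mfderiv 𝓘(ℝ, E) 𝓘(ℝ, F) φ x).toLinearMap)ᗮ)
    (hz : z ∈ (LinearMap.ker (mfderiv 𝓘(ℝ, E) 𝓘(ℝ, F) φ x).toLinearMap)ᗮ) :
    inner ℝ (nablaDiff φ x v v) (mfderiv 𝓘(ℝ, E) 𝓘(ℝ, F) φ x z) =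
      inner ℝ (grad (μ i₀) x) v * inner ℝ v z
        - (1 / 2) * (inner ℝ (grad (μ i₀) x) z * inner ℝ v v) := by
  have hD : ∀ {a b c : TangentSpace 𝓘(ℝ, E) x}, _ → _ → _ := fun {a b c} ha hb ↦
    fderiv_pullbackRep_of_conformal hφ hμ hd heq i₀ (v := a) (w := b) ha hb c
  rw [inner_nablaDiff hφ, real_inner_comm (mfderiv 𝓘(ℝ, E) 𝓘(ℝ, F) φ x z),
    inner_mfderiv_mfderiv_of_mem_orthogonal hφ hμ heq i₀ hz, real_inner_comm (christoffel v v),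
    inner_christoffel, koszul_eq_koszulForm]
  simp only [koszulForm]
  rw [hD hv hz, hD hv hv]
  ring

omit [FiniteDimensional ℝ E] in
omit hd heq in
lemma eventually_diffNorm_eq [FiniteDimensional ℝ E] :
    ∀ᶠ z in 𝓝 x, diffNorm E F φ z = √(∑ i, μ i z) := by
  filter_upwards [hμ] with z ⟨e, he, heig⟩
  rw [diffNorm]
  congr 1
  exact sum_norm_sq_map (A := (mfderiv 𝓘(ℝ, E) 𝓘(ℝ, F) φ z).toLinearMap)
    rfl he (fun i ↦ (heig i).1) (fun i ↦ (heig i).2) _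

omit hd in
lemma diffNorm_pos (i₀ : Fin (Module.finrank ℝ F)) : 0 < diffNorm E F φ x := by
  rw [(eventually_diffNorm_eq (E := E) (F := F) hφ hμ).self_of_nhds, Real.sqrt_pos]
  exact Finset.sum_pos (fun i _ ↦ (eventually_eigenvalue_pos (E := E) (F := F) hμ).self_of_nhds i)
    ⟨i₀, by simp⟩

/-- Here `‖dφ‖²` is the sum of the `n` eigenvalues, which share value and gradient at `x`; `n`
cancels in the logarithmic derivative and the square root gives the factor `1 / 2`. -/
lemma grad_log_diffNorm (i₀ : Fin (Module.finrank ℝ F)) :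
    grad (E := E) (fun z ↦ Real.log (diffNorm E F φ z)) x = (2 * μ i₀ x)⁻¹ • grad (E := E) (μ i₀) x := by
  have hpos := (eventually_eigenvalue_pos (E := E) (F := F) hμ).self_of_nhds i₀
  refine ext_inner_right ℝ fun v ↦ ?_
  rw [inner_grad, real_inner_smul_left, inner_grad, mvfderiv_eq_fderiv (hd i₀)]
  set u₀ := extChartAt 𝓘(ℝ, E) x x with hu₀
  have hs : HasFDerivAt (fun u ↦ ∑ i, μ i ((extChartAt 𝓘(ℝ, E) x).symm u))
      (∑ i : Fin (Module.finrank ℝ F), fderiv ℝ (μ i ∘ (extChartAt 𝓘(ℝ, E) x).symm) u₀) u₀ :=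
    HasFDerivAt.fun_sum fun i _ ↦ (differentiableAt_comp_chart_symm (hd i)).hasFDerivAt
  have hval : ∑ i, μ i ((extChartAt 𝓘(ℝ, E) x).symm u₀) = Module.finrank ℝ F * μ i₀ x := by
    simp [hu₀, (heq _ i₀).1]
  have hn : (0 : ℝ) < Module.finrank ℝ F := by exact_mod_cast i₀.pos
  have hval' : ∑ i, μ i ((extChartAt 𝓘(ℝ, E) x).symm u₀) ≠ 0 := by
    rw [hval]; positivity
  have hl := (hs.log hval').const_mul (1 / 2)
  rw [mvfderiv_comp_chart hl.differentiableAt, hl.fderiv, hval]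
  · rw [Finset.sum_congr rfl fun i _ ↦ fderiv_eigenvalue_eq hd heq i i₀]
    simp only [Finset.sum_const, Finset.card_univ, Fintype.card_fin, smul_apply, smul_eq_mul,
      ← Nat.cast_smul_eq_nsmul ℝ]
    rw [hu₀]
    field_simp
  · filter_upwards [eventually_diffNorm_eq hφ hμ, eventually_mem_chart_source (E := E) x,
      eventually_eigenvalue_pos (E := E) (F := F) hμ] with z hz hzs hzpos
    rw [(extChartAt 𝓘(ℝ, E) x).left_inv (by simpa using hzs), hz,
      Real.log_sqrt (Finset.sum_nonneg fun i _ ↦ (hzpos i).le)]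
    ring

end Conformal

/-! ### Zero sets of submersions: tangent spaces and tangent fields -/

section Submanifold

variable {F : Type*} [NormedAddCommGroup F] [NormedSpace ℝ F]
  {N : Type*} [TopologicalSpace N] [ChartedSpace F N] [IsManifold 𝓘(ℝ, F) ∞ N]
  {G : Type*} [NormedAddCommGroup G] [NormedSpace ℝ G] [FiniteDimensional ℝ G]

variable (F) in
/-- The submanifold `B` is the zero set of the submersion `f` on the open set `U`. -/
structure IsZeroSetOn (B U : Set N) (f : N → G) : Prop where
  isOpen : IsOpen U
  contMDiffOn : ContMDiffOn 𝓘(ℝ, F) 𝓘(ℝ, G) ∞ f U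
  mem_iff : ∀ z ∈ U, z ∈ B ↔ f z = 0
  surjective : ∀ z ∈ U, Function.Surjective (mvfderiv 𝓘(ℝ, F) f z)

lemma mvfderiv_clm_comp {f : N → G} {y : N} (hf : MDifferentiableAt 𝓘(ℝ, F) 𝓘(ℝ, G) f y)
    (Λ : G →L[ℝ] ℝ) (v : TangentSpace 𝓘(ℝ, F) y) :
    mvfderiv 𝓘(ℝ, F) (fun z ↦ Λ (f z)) y v = Λ (mvfderiv 𝓘(ℝ, F) f y v) := by
  have h := differentiableAt_comp_chart_symm hf
  have hd : MDifferentiableAt 𝓘(ℝ, F) 𝓘(ℝ) (fun z ↦ Λ (f z)) y :=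
    MDifferentiableAt.comp y Λ.differentiableAt.mdifferentiableAt hf
  rw [mvfderiv_eq_fderiv hd, mvfderiv_eq_fderiv hf]
  exact DFunLike.congr_fun (Λ.hasFDerivAt.comp _ h.hasFDerivAt).fderiv _

/-- Vector valued functions vanishing on `B` have differentials vanishing on tangent vectors. -/
lemma mvfderiv_eq_zero_of_mem_tangentTo {B : Set N} {y : N} {v : TangentSpace 𝓘(ℝ, F) y}
    (hv : v ∈ tangentTo F B y) {f : N → G} (hf : ContMDiffAt 𝓘(ℝ, F) 𝓘(ℝ, G) ∞ f y)
    (hB : ∀ᶠ z in 𝓝[B] y, f z = 0) : mvfderiv 𝓘(ℝ, F) f y v = 0 := by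
  refine SeparatingDual.eq_zero_of_forall_dual_eq_zero (R := ℝ) fun Λ ↦ ?_
  rw [← mvfderiv_clm_comp (hf.mdifferentiableAt (by simp))]
  refine hv _ (Λ.contDiff.contMDiff.contMDiffAt.comp y hf) ?_
  filter_upwards [hB] with z hz
  rw [hz, map_zero]

variable {B U : Set N} {f : N → G} (hf : IsZeroSetOn F B U f) {y : N}

include hf

namespace IsZeroSetOn

lemma contMDiffAt (hyU : y ∈ U) : ContMDiffAt 𝓘(ℝ, F) 𝓘(ℝ, G) ∞ f y :=
  hf.contMDiffOn.contMDiffAt (hf.isOpen.mem_nhds hyU)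

lemma eventually_eq_zero (hyU : y ∈ U) : ∀ᶠ z in 𝓝[B] y, f z = 0 := by
  filter_upwards [self_mem_nhdsWithin, nhdsWithin_le_nhds (hf.isOpen.mem_nhds hyU)] with z hz hzU
  exact (hf.mem_iff z hzU).1 hz

variable [CompleteSpace F]

/-- The tangent space of the zero set of a submersion is the kernel of its differential. -/
lemma mem_tangentTo_iff (hyU : y ∈ U) (hyB : y ∈ B) (v : TangentSpace 𝓘(ℝ, F) y) :
    v ∈ tangentTo F B y ↔ mvfderiv 𝓘(ℝ, F) f y v = 0 := by
  refine ⟨fun hv ↦ mvfderiv_eq_zero_of_mem_tangentTo hv (hf.contMDiffAt hyU)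
    (hf.eventually_eq_zero hyU), fun hv g hg hgB ↦ ?_⟩
  have hfd := (hf.contMDiffAt hyU).mdifferentiableAt (by simp)
  have hgd := hg.mdifferentiableAt (by simp)
  set u₀ := extChartAt 𝓘(ℝ, F) y y with hu₀
  set f' := f ∘ (extChartAt 𝓘(ℝ, F) y).symm with hf'
  set g' := g ∘ (extChartAt 𝓘(ℝ, F) y).symm with hg'
  have hfs : HasStrictFDerivAt f' (fderiv ℝ f' u₀) u₀ :=
    (contDiffAt_comp_chart_symm (hf.contMDiffAt hyU)).hasStrictFDerivAt (by simp)
  have hgs : HasStrictFDerivAt g' (fderiv ℝ g' u₀) u₀ :=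
    (contDiffAt_comp_chart_symm hg).hasStrictFDerivAt (by simp)
  have hfy : f y = 0 := (hf.mem_iff y hyU).1 hyB
  have hgy : g y = 0 := hgB.self_of_nhdsWithin hyB
  -- As `g'` vanishes on the level set of `f'`, the point is trivially an extremum there, and
  -- Lagrange multipliers relate the two differentials.
  have hmin : IsLocalExtrOn g' {u | f' u = f' u₀} u₀ := by
    left
    rw [eventually_nhdsWithin_iff] at hgB
    change ∀ᶠ u in 𝓝[{u | f' u = f' u₀}] u₀, g' u₀ ≤ g' u
    rw [eventually_nhdsWithin_iff]
    filter_upwards [eventually_chart_symm hgB,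
      eventually_chart_symm (hf.isOpen.mem_nhds hyU)] with u hu hU hfu
    have h1 : f ((extChartAt 𝓘(ℝ, F) y).symm u) = 0 := by
      have h2 : f' u = f' u₀ := hfu
      simpa [hf', hu₀, hfy] using h2
    have h2 : g' u = 0 := hu ((hf.mem_iff _ hU).2 h1)
    have h3 : g' u₀ = 0 := by simp [hg', hu₀, hgy]
    rw [h2, h3]
  obtain ⟨Λ, c, hne, hΛ⟩ := hmin.exists_linear_map_of_hasStrictFDerivAt hfs hgs
  have hΛ' : ∀ w : TangentSpace 𝓘(ℝ, F) y,
      Λ (mvfderiv 𝓘(ℝ, F) f y w) + c * mvfderiv 𝓘(ℝ, F) g y w = 0 := by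
    intro w
    rw [mvfderiv_eq_fderiv hfd, mvfderiv_eq_fderiv hgd]
    exact hΛ _
  -- With `c = 0` the multiplier `Λ` would vanish on the range of `df`, which is everything,
  -- contradicting nontriviality.
  have hc : c ≠ 0 := by
    rintro rfl
    refine hne (Prod.ext (LinearMap.ext fun u ↦ ?_) rfl)
    obtain ⟨w, rfl⟩ := hf.surjective y hyU u
    simpa using hΛ' w
  have := hΛ' v
  rw [hv, map_zero, zero_add] at this
  exact (mul_eq_zero.1 this).resolve_left hc

/-- The second fundamental form uses a chosen tangent extension, so one must exist. A constant field
is projected to the kernel of `df` along the range of a fixed right inverse `R` of `df` at `y`; the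
correction `R (df R)⁻¹ df w` is smooth near `y` and zero at `y`. -/
lemma exists_isTangentExtension [FiniteDimensional ℝ F] (hyU : y ∈ U) (hyB : y ∈ B)
    {w : TangentSpace 𝓘(ℝ, F) y} (hw : w ∈ tangentTo F B y) :
    ∃ Y, IsTangentExtension F B y w Y := by
  set u₀ := extChartAt 𝓘(ℝ, F) y y with hu₀
  set f' := f ∘ (extChartAt 𝓘(ℝ, F) y).symm with hf'
  have hfd := (hf.contMDiffAt hyU).mdifferentiableAt (by simp)
  have hsurj : Function.Surjective (fderiv ℝ f' u₀) := by
    intro u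
    obtain ⟨v, rfl⟩ := hf.surjective y hyU u
    exact ⟨toModel y y v, (mvfderiv_eq_fderiv hfd v).symm⟩
  obtain ⟨R', hR'⟩ := (fderiv ℝ f' u₀).toLinearMap.exists_rightInverse_of_surjective
    (LinearMap.range_eq_top.2 hsurj)
  set R : G →L[ℝ] F := LinearMap.toContinuousLinearMap R' with hR
  have hDs : ContDiffAt ℝ ∞ (fderiv ℝ f') u₀ :=
    (contDiffAt_comp_chart_symm (hf.contMDiffAt hyU)).fderiv_right (by norm_cast)
  set T : F → G →L[ℝ] G := fun u ↦ (fderiv ℝ f' u).comp R with hT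
  have hTs : ContDiffAt ℝ ∞ T u₀ := hDs.clm_comp contDiffAt_const
  have hT0 : T u₀ = ContinuousLinearEquiv.refl ℝ G := by
    ext u
    exact LinearMap.congr_fun hR' u
  have hTi : ContDiffAt ℝ ∞ (fun u ↦ (T u).inverse) u₀ := by
    have h := contDiffAt_map_inverse (n := ∞) (ContinuousLinearEquiv.refl ℝ G)
    rw [← hT0] at h
    exact h.comp u₀ hTs
  set Z : F → F := fun u ↦ toModel y y w -
    R ((T u).inverse (fderiv ℝ f' u (toModel y y w))) with hZ
  have hZs : ContDiffAt ℝ ∞ Z u₀ :=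
    contDiffAt_const.sub (contDiffAt_const.clm_apply
      (hTi.clm_apply (hDs.clm_apply contDiffAt_const)))
  have hDw : fderiv ℝ f' u₀ (toModel y y w) = 0 := by
    rw [← mvfderiv_eq_fderiv hfd]
    exact (hf.mem_tangentTo_iff hyU hyB w).1 hw
  have hZ0 : Z u₀ = toModel y y w := by
    simp only [hZ, hDw, map_zero, sub_zero]
  have hZT : ∀ᶠ u in 𝓝 u₀, fderiv ℝ f' u (Z u) = 0 := by
    -- `T` is the identity at `u₀` and the invertible operators form a neighbourhood of it, so
    -- `inverse` is a true inverse nearby rather than its default value.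
    have h := hTs.continuousAt.eventually
      (hT0 ▸ ContinuousLinearEquiv.nhds (ContinuousLinearEquiv.refl ℝ G))
    filter_upwards [h] with u ⟨e, he⟩
    have h1 : ∀ k, fderiv ℝ f' u (R k) = e k := fun k ↦ DFunLike.congr_fun he.symm k
    rw [hZ]
    simp only [map_sub, h1]
    rw [← he, ContinuousLinearMap.inverse_equiv]
    simp
  refine ⟨fun z ↦ ofModel y z (Z (extChartAt 𝓘(ℝ, F) y z)), ?_, ?_, ?_⟩
  · rw [contMDiffAt_section]
    have h1 : ContMDiffAt 𝓘(ℝ, F) 𝓘(ℝ, F) ∞ (Z ∘ extChartAt 𝓘(ℝ, F) y) y :=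
      ContMDiffAt.comp (g := Z) y hZs.contMDiffAt (contMDiffAt_extChartAt)
    refine h1.congr_of_eventuallyEq ?_
    filter_upwards [eventually_mem_chart_source (E := F) y] with z hz
    have := coords_eq_toModel hz (ofModel y z (Z (extChartAt 𝓘(ℝ, F) y z)))
    rw [toModel_ofModel hz] at this
    exact this
  · change ofModel y y (Z u₀) = w
    rw [hZ0, ofModel_toModel_self]
  · have h1 : ∀ᶠ z in 𝓝 y, fderiv ℝ f' (extChartAt 𝓘(ℝ, F) y z)
        (Z (extChartAt 𝓘(ℝ, F) y z)) = 0 :=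
      (continuousAt_extChartAt (I := 𝓘(ℝ, F)) y).eventually hZT
    filter_upwards [self_mem_nhdsWithin, nhdsWithin_le_nhds h1,
      nhdsWithin_le_nhds (hf.isOpen.mem_nhds hyU),
      nhdsWithin_le_nhds (eventually_mem_chart_source (E := F) y)] with z hzB hz hzU hzs
    rw [hf.mem_tangentTo_iff hzU hzB,
      mvfderiv_ofModel hzs ((hf.contMDiffAt hzU).mdifferentiableAt (by simp))]
    exact hz

end IsZeroSetOn

end Submanifold

/-! ### Second fundamental form through the Hessian of a defining function -/

section Hessian

variable {F : Type*} [NormedAddCommGroup F] [NormedSpace ℝ F] [FiniteDimensional ℝ F]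
  {N : Type*} [TopologicalSpace N] [ChartedSpace F N] [IsManifold 𝓘(ℝ, F) ∞ N]
  [RiemannianBundle (fun y : N ↦ TangentSpace 𝓘(ℝ, F) y)]
  [IsContMDiffRiemannianBundle 𝓘(ℝ, F) ∞ F (fun y : N ↦ TangentSpace 𝓘(ℝ, F) y)]
  {G : Type*} [NormedAddCommGroup G] [NormedSpace ℝ G] [FiniteDimensional ℝ G]

/-- The Christoffel symbol as a bilinear map. -/
def christoffelBilin (y : N) :
    TangentSpace 𝓘(ℝ, F) y →ₗ[ℝ] TangentSpace 𝓘(ℝ, F) y →ₗ[ℝ] TangentSpace 𝓘(ℝ, F) y :=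
  LinearMap.mk₂ ℝ christoffel
    (fun a b c ↦ ext_inner_right ℝ fun z ↦ by
      simp only [inner_add_left, inner_christoffel, koszul_eq_koszulForm, koszulForm, map_add,
        add_apply]
      ring)
    (fun r a b ↦ ext_inner_right ℝ fun z ↦ by
      simp only [real_inner_smul_left, inner_christoffel, koszul_eq_koszulForm, koszulForm,
        map_smul, smul_apply, smul_eq_mul]
      ring)
    (fun a b c ↦ ext_inner_right ℝ fun z ↦ by
      simp only [inner_add_left, inner_christoffel, koszul_eq_koszulForm, koszulForm, map_add,
        add_apply]
      ring)
    (fun r a b ↦ ext_inner_right ℝ fun z ↦ by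
      simp only [real_inner_smul_left, inner_christoffel, koszul_eq_koszulForm, koszulForm,
        map_smul, smul_apply, smul_eq_mul]
      ring)

@[simp] lemma christoffelBilin_apply (y : N) (v w : TangentSpace 𝓘(ℝ, F) y) :
    christoffelBilin y v w = christoffel v w := rfl

/-- The Hessian of a vector valued function. -/
def hessian (f : N → G) (y : N) :
    TangentSpace 𝓘(ℝ, F) y →ₗ[ℝ] TangentSpace 𝓘(ℝ, F) y →ₗ[ℝ] G :=
  LinearMap.mk₂ ℝ (fun v w ↦ fderiv ℝ (fderiv ℝ (f ∘ (extChartAt 𝓘(ℝ, F) y).symm))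
      (extChartAt 𝓘(ℝ, F) y y) (toModel y y v) (toModel y y w)
      - mvfderiv 𝓘(ℝ, F) f y (christoffelBilin y v w))
    (fun a b c ↦ by simp only [map_add, add_apply, LinearMap.add_apply]; abel)
    (fun r a b ↦ by simp only [map_smul, smul_apply, LinearMap.smul_apply, smul_sub])
    (fun a b c ↦ by simp only [map_add]; abel)
    (fun r a b ↦ by simp only [map_smul, smul_sub])

lemma hessian_apply (f : N → G) (y : N) (v w : TangentSpace 𝓘(ℝ, F) y) :
    hessian f y v w = fderiv ℝ (fderiv ℝ (f ∘ (extChartAt 𝓘(ℝ, F) y).symm))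
      (extChartAt 𝓘(ℝ, F) y y) (toModel y y v) (toModel y y w)
      - mvfderiv 𝓘(ℝ, F) f y (christoffel v w) := rfl

variable {B U : Set N} {f : N → G} {y : N}

namespace IsZeroSetOn

/-- The normal part of the covariant derivative of a tangent field is given by the Hessian of a
defining function. -/
lemma mvfderiv_leviCivita (hf : IsZeroSetOn F B U f) (hyU : y ∈ U)
    {v w : TangentSpace 𝓘(ℝ, F) y}
    (hv : v ∈ tangentTo F B y) {Y : Π z : N, TangentSpace 𝓘(ℝ, F) z}
    (hY : IsTangentExtension F B y w Y) :
    mvfderiv 𝓘(ℝ, F) f y (leviCivita Y y v) = - hessian f y v w := by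
  obtain ⟨hYs, hYy, hYB⟩ := hY
  have hfd := (hf.contMDiffAt hyU).mdifferentiableAt (by simp)
  set u₀ := extChartAt 𝓘(ℝ, F) y y with hu₀
  set f' := f ∘ (extChartAt 𝓘(ℝ, F) y).symm with hf'
  have hDs : ContDiffAt ℝ ∞ (fderiv ℝ f') u₀ :=
    (contDiffAt_comp_chart_symm (hf.contMDiffAt hyU)).fderiv_right (by norm_cast)
  rw [contMDiffAt_section] at hYs
  have hcs : ContMDiffAt 𝓘(ℝ, F) 𝓘(ℝ, F) ∞ (fun z ↦ coords y (Y z)) y := hYs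
  set Z : F → F := (fun z ↦ coords y (Y z)) ∘ (extChartAt 𝓘(ℝ, F) y).symm with hZ
  have hZs : ContDiffAt ℝ ∞ Z u₀ := contDiffAt_comp_chart_symm hcs
  have hZ0 : Z u₀ = toModel y y w := by
    have h : ∀ z, z = y → coords y (Y z) = toModel y y w := by
      rintro z rfl
      rw [hYy, coords_eq_toModel (mem_chart_source F z)]
    exact h _ (extChartAt_to_inv y)
  have hks : ContDiffAt ℝ ∞ (fun u ↦ fderiv ℝ f' u (Z u)) u₀ := hDs.clm_apply hZs
  have hkm : ContMDiffAt 𝓘(ℝ, F) 𝓘(ℝ, G) ∞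
      ((fun u ↦ fderiv ℝ f' u (Z u)) ∘ extChartAt 𝓘(ℝ, F) y) y :=
    ContMDiffAt.comp (g := fun u ↦ fderiv ℝ f' u (Z u)) y hks.contMDiffAt contMDiffAt_extChartAt
  -- The function `df(Y)`, read in the chart, vanishes on `B`. Its derivative along the tangent
  -- vector `v` is therefore zero, and the product rule relates `df(∂_v Y)` to the second derivative
  -- of `f`.
  have hzero : ∀ᶠ z in 𝓝[B] y,
      ((fun u ↦ fderiv ℝ f' u (Z u)) ∘ extChartAt 𝓘(ℝ, F) y) z = 0 := by
    filter_upwards [hYB, nhdsWithin_le_nhds (hf.isOpen.mem_nhds hyU), self_mem_nhdsWithin,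
      nhdsWithin_le_nhds (eventually_mem_chart_source (E := F) y)] with z hz hzU hzB hzs
    have h1 := (hf.mem_tangentTo_iff hzU hzB _).1 hz
    rw [← ofModel_toModel hzs (Y z),
      mvfderiv_ofModel hzs ((hf.contMDiffAt hzU).mdifferentiableAt (by simp)),
      ← coords_eq_toModel hzs] at h1
    have h : ∀ z', z' = z → coords y (Y z') = coords y (Y z) := by
      rintro _ rfl
      rfl
    rw [← h _ ((extChartAt 𝓘(ℝ, F) y).left_inv (by simpa using hzs))] at h1
    exact h1
  have hkey := mvfderiv_eq_zero_of_mem_tangentTo hv hkm hzero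
  have hDd : DifferentiableAt ℝ (fderiv ℝ f') u₀ := hDs.differentiableAt (by simp)
  have hZd : DifferentiableAt ℝ Z u₀ := hZs.differentiableAt (by simp)
  have hcomp := mvfderiv_comp_chart (f := (fun u ↦ fderiv ℝ f' u (Z u)) ∘ extChartAt 𝓘(ℝ, F) y)
    (hks.differentiableAt (by simp)) (Filter.Eventually.of_forall fun z ↦ rfl) v
  rw [hcomp, fderiv_clm_apply hDd hZd, hZ0] at hkey
  have hcd : mvfderiv 𝓘(ℝ, F) (fun z ↦ coords y (Y z)) y v = fderiv ℝ Z u₀ (toModel y y v) :=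
    mvfderiv_eq_fderiv (hcs.mdifferentiableAt (by simp)) v
  rw [leviCivita, map_add, hcd, ofCoords_eq_ofModel, mvfderiv_ofModel (mem_chart_source F y) hfd,
    hessian_apply, hYy, neg_sub, ← hf', ← hu₀]
  have hkey' : fderiv ℝ f' u₀ (fderiv ℝ Z u₀ (toModel y y v)) +
      fderiv ℝ (fderiv ℝ f') u₀ (toModel y y v) (toModel y y w) = 0 := hkey
  rw [eq_neg_of_add_eq_zero_left hkey']
  abel

lemma mvfderiv_starProjection (hf : IsZeroSetOn F B U f) (hyU : y ∈ U) (hyB : y ∈ B)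
    (v : TangentSpace 𝓘(ℝ, F) y) :
    mvfderiv 𝓘(ℝ, F) f y ((tangentTo F B y)ᗮ.starProjection v) = mvfderiv 𝓘(ℝ, F) f y v := by
  rw [← sub_eq_zero, ← map_sub, ← hf.mem_tangentTo_iff hyU hyB, ← neg_mem_iff, neg_sub,
    Submodule.starProjection_orthogonal']
  simp

lemma mvfderiv_secondFundamentalForm (hf : IsZeroSetOn F B U f) (hyU : y ∈ U) (hyB : y ∈ B)
    {v w : TangentSpace 𝓘(ℝ, F) y} (hv : v ∈ tangentTo F B y) (hw : w ∈ tangentTo F B y) :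
    mvfderiv 𝓘(ℝ, F) f y (secondFundamentalForm F B y v w) = - hessian f y v w := by
  rw [secondFundamentalForm, hf.mvfderiv_starProjection hyU hyB]
  exact hf.mvfderiv_leviCivita hyU hv
    (Classical.epsilon_spec (hf.exists_isTangentExtension hyU hyB hw))

/-- The mean curvature of the zero set of `f` vanishes iff the trace of the Hessian of `f` over the
tangent space does. -/
lemma meanCurvature_eq_zero_iff (hf : IsZeroSetOn F B U f) (hyU : y ∈ U) (hyB : y ∈ B) :
    meanCurvature F B y = 0 ↔
      ∑ i, hessian f y (stdOrthonormalBasis ℝ (tangentTo F B y) i : TangentSpace 𝓘(ℝ, F) y)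
        (stdOrthonormalBasis ℝ (tangentTo F B y) i : TangentSpace 𝓘(ℝ, F) y) = 0 := by
  have h1 : mvfderiv 𝓘(ℝ, F) f y (meanCurvature F B y) =
      - ∑ i, hessian f y (stdOrthonormalBasis ℝ (tangentTo F B y) i : TangentSpace 𝓘(ℝ, F) y)
        (stdOrthonormalBasis ℝ (tangentTo F B y) i : TangentSpace 𝓘(ℝ, F) y) := by
    rw [meanCurvature, map_sum, ← Finset.sum_neg_distrib]
    exact Finset.sum_congr rfl fun i _ ↦
      hf.mvfderiv_secondFundamentalForm hyU hyB (Subtype.coe_prop _) (Subtype.coe_prop _)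
  -- Being normal, the mean curvature vanishes once `df` annihilates it, since it is then also
  -- tangent.
  have h2 : meanCurvature F B y ∈ (tangentTo F B y)ᗮ :=
    Submodule.sum_mem _ fun i _ ↦ Submodule.starProjection_apply_mem _ _
  rw [← neg_eq_zero (a := ∑ i, _), ← h1, ← hf.mem_tangentTo_iff hyU hyB]
  refine ⟨fun h ↦ h ▸ zero_mem _, fun h ↦ ?_⟩
  have := Submodule.inner_right_of_mem_orthogonal h h2
  exact inner_self_eq_zero.1 this

end IsZeroSetOn

end Hessian

lemma fderiv_fderiv_comp {E F G : Type*} [NormedAddCommGroup E] [NormedSpace ℝ E]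
    [NormedAddCommGroup F] [NormedSpace ℝ F] [NormedAddCommGroup G] [NormedSpace ℝ G]
    {g : F → G} {f : E → F} {u : E} (hg : ContDiffAt ℝ ∞ g (f u)) (hf : ContDiffAt ℝ ∞ f u)
    (a b : E) :
    fderiv ℝ (fderiv ℝ (g ∘ f)) u a b =
      fderiv ℝ (fderiv ℝ g) (f u) (fderiv ℝ f u a) (fderiv ℝ f u b)
        + fderiv ℝ g (f u) (fderiv ℝ (fderiv ℝ f) u a b) := by
  have hgd : DifferentiableAt ℝ (fderiv ℝ g) (f u) :=
    (hg.fderiv_right (m := 1) (by norm_cast)).differentiableAt (by simp)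
  have hfd : DifferentiableAt ℝ (fderiv ℝ f) u :=
    (hf.fderiv_right (m := 1) (by norm_cast)).differentiableAt (by simp)
  have hfu : DifferentiableAt ℝ f u := hf.differentiableAt (by simp)
  have heq : fderiv ℝ (g ∘ f) =ᶠ[𝓝 u] fun z ↦ (fderiv ℝ g (f z)).comp (fderiv ℝ f z) := by
    filter_upwards [(hf.of_le (m := 1) (by simp)).eventually (by simp),
      hf.continuousAt.eventually ((hg.of_le (m := 1) (by simp)).eventually (by simp))] with z h1 h2
    exact fderiv_comp z (h2.differentiableAt (by simp)) (h1.differentiableAt (by simp))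
  have hgf : DifferentiableAt ℝ (fun z ↦ fderiv ℝ g (f z)) u :=
    DifferentiableAt.comp (g := fderiv ℝ g) u hgd hfu
  have h3 : fderiv ℝ (fun z ↦ fderiv ℝ g (f z)) u = (fderiv ℝ (fderiv ℝ g) (f u)).comp (fderiv ℝ f u) :=
    fderiv_comp (g := fderiv ℝ g) u hgd hfu
  rw [heq.fderiv_eq, fderiv_clm_comp hgf hfd, h3]
  simp [add_comm]

/-! ### Preimages of submanifolds and the Hessian of a composition -/

section Preimage

variable {E : Type*} [NormedAddCommGroup E] [NormedSpace ℝ E] [FiniteDimensional ℝ E]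
  {F : Type*} [NormedAddCommGroup F] [NormedSpace ℝ F] [FiniteDimensional ℝ F]
  {M : Type*} [TopologicalSpace M] [ChartedSpace E M] [IsManifold 𝓘(ℝ, E) ∞ M]
  {N : Type*} [TopologicalSpace N] [ChartedSpace F N] [IsManifold 𝓘(ℝ, F) ∞ N]
  {G : Type*} [NormedAddCommGroup G] [NormedSpace ℝ G] [FiniteDimensional ℝ G]
  {φ : M → N} {B U : Set N} {f : N → G}

omit [FiniteDimensional ℝ E] [FiniteDimensional ℝ F] [FiniteDimensional ℝ G] in
lemma mvfderiv_comp_map {x : M} (hf : MDifferentiableAt 𝓘(ℝ, F) 𝓘(ℝ, G) f (φ x))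
    (hφ : MDifferentiableAt 𝓘(ℝ, E) 𝓘(ℝ, F) φ x) (v : TangentSpace 𝓘(ℝ, E) x) :
    mvfderiv 𝓘(ℝ, E) (f ∘ φ) x v =
      mvfderiv 𝓘(ℝ, F) f (φ x) (mfderiv 𝓘(ℝ, E) 𝓘(ℝ, F) φ x v) := by
  rw [mvfderiv, mfderiv_comp x hf hφ]
  rfl

lemma IsZeroSetOn.comp (hf : IsZeroSetOn F B U f) (hφ : IsSubmersive E F φ) :
    IsZeroSetOn E (φ ⁻¹' B) (φ ⁻¹' U) (f ∘ φ) where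
  isOpen := hf.isOpen.preimage hφ.1.continuous
  contMDiffOn := hf.contMDiffOn.comp hφ.1.contMDiffOn fun _ h ↦ h
  mem_iff z hz := hf.mem_iff (φ z) hz
  surjective z hz := by
    intro u
    obtain ⟨w, rfl⟩ := hf.surjective (φ z) hz u
    obtain ⟨v, rfl⟩ := hφ.2 z w
    exact ⟨v, mvfderiv_comp_map ((hf.contMDiffAt hz).mdifferentiableAt (by simp))
      (hφ.1.mdifferentiableAt (by simp)) v⟩

lemma IsSubmanifold.exists_isZeroSetOn {p : ℕ} (hB : IsSubmanifold F p B) {y : N} (hy : y ∈ B) :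
    ∃ (U : Set N) (f : N → EuclideanSpace ℝ (Fin p)), y ∈ U ∧ IsZeroSetOn F B U f := by
  obtain ⟨U, f, h1, h2, h3, h4, h5⟩ := hB y hy
  exact ⟨U, f, h2, h1, h3, h4, h5⟩

lemma IsSubmanifold.preimage {p : ℕ} (hB : IsSubmanifold F p B) (hφ : IsSubmersive E F φ) :
    IsSubmanifold E p (φ ⁻¹' B) := by
  intro x hx
  obtain ⟨U, f, hxU, hf⟩ := hB.exists_isZeroSetOn hx
  have h := hf.comp hφ
  exact ⟨φ ⁻¹' U, f ∘ φ, h.isOpen, hxU, h.contMDiffOn, h.mem_iff, h.surjective⟩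

lemma tangentTo_preimage {p : ℕ} (hB : IsSubmanifold F p B) (hφ : IsSubmersive E F φ) {x : M}
    (hx : φ x ∈ B) :
    tangentTo E (φ ⁻¹' B) x =
      (tangentTo F B (φ x)).comap (mfderiv 𝓘(ℝ, E) 𝓘(ℝ, F) φ x).toLinearMap := by
  obtain ⟨U, f, hxU, hf⟩ := hB.exists_isZeroSetOn hx
  ext v
  rw [Submodule.mem_comap, (hf.comp hφ).mem_tangentTo_iff hxU hx,
    mvfderiv_comp_map ((hf.contMDiffAt hxU).mdifferentiableAt (by simp))
      (hφ.1.mdifferentiableAt (by simp))]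
  exact (hf.mem_tangentTo_iff hxU hx _).symm

variable [RiemannianBundle (fun x : M ↦ TangentSpace 𝓘(ℝ, E) x)]
  [IsContMDiffRiemannianBundle 𝓘(ℝ, E) ∞ E (fun x : M ↦ TangentSpace 𝓘(ℝ, E) x)]

lemma finrank_orthogonal_tangentTo {p : ℕ} (hB : IsSubmanifold E p (φ ⁻¹' B)) {x : M}
    (hx : φ x ∈ B) :
    Module.finrank ℝ ((tangentTo E (φ ⁻¹' B) x)ᗮ : Submodule ℝ (TangentSpace 𝓘(ℝ, E) x)) = p := by
  obtain ⟨U, f, hxU, hf⟩ := hB.exists_isZeroSetOn hx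
  have hker : tangentTo E (φ ⁻¹' B) x = LinearMap.ker (mvfderiv 𝓘(ℝ, E) f x).toLinearMap := by
    ext v
    rw [hf.mem_tangentTo_iff hxU hx]
    rfl
  have h1 := (tangentTo E (φ ⁻¹' B) x).finrank_add_finrank_orthogonal
  have h2 := (mvfderiv 𝓘(ℝ, E) f x).toLinearMap.finrank_range_add_finrank_ker
  rw [LinearMap.range_eq_top.2 (hf.surjective x hxU), finrank_top, finrank_euclideanSpace_fin,
    ← hker] at h2
  omega

variable [RiemannianBundle (fun y : N ↦ TangentSpace 𝓘(ℝ, F) y)]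
  [IsContMDiffRiemannianBundle 𝓘(ℝ, F) ∞ F (fun y : N ↦ TangentSpace 𝓘(ℝ, F) y)]

/-- The second fundamental form of a map as a bilinear map. -/
def nablaDiffBilin (hφ : ContMDiff 𝓘(ℝ, E) 𝓘(ℝ, F) ∞ φ) (x : M) :
    TangentSpace 𝓘(ℝ, E) x →ₗ[ℝ] TangentSpace 𝓘(ℝ, E) x →ₗ[ℝ] TangentSpace 𝓘(ℝ, F) (φ x) :=
  LinearMap.mk₂ ℝ (nablaDiff φ x)
    (fun a b c ↦ by
      simp only [nablaDiff_eq hφ, ← christoffelBilin_apply, map_add, add_apply,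
        LinearMap.add_apply]
      abel)
    (fun r a b ↦ by
      simp only [nablaDiff_eq hφ, ← christoffelBilin_apply, map_smul, smul_apply,
        LinearMap.smul_apply, smul_sub, smul_add])
    (fun a b c ↦ by
      simp only [nablaDiff_eq hφ, ← christoffelBilin_apply, map_add]
      abel)
    (fun r a b ↦ by
      simp only [nablaDiff_eq hφ, ← christoffelBilin_apply, map_smul, smul_sub, smul_add])

/-- This is the second-order chain rule in charts; the Christoffel term of `N` occurs in `Hess f`
and in `∇dφ` with opposite signs and cancels. -/
lemma hessian_comp (hφ : ContMDiff 𝓘(ℝ, E) 𝓘(ℝ, F) ∞ φ) {x : M}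
    (hf : ContMDiffAt 𝓘(ℝ, F) 𝓘(ℝ, G) ∞ f (φ x)) (v w : TangentSpace 𝓘(ℝ, E) x) :
    hessian (f ∘ φ) x v w =
      hessian f (φ x) (mfderiv 𝓘(ℝ, E) 𝓘(ℝ, F) φ x v) (mfderiv 𝓘(ℝ, E) 𝓘(ℝ, F) φ x w)
        + mvfderiv 𝓘(ℝ, F) f (φ x) (nablaDiff φ x v w) := by
  have hφd : MDifferentiableAt 𝓘(ℝ, E) 𝓘(ℝ, F) φ x := hφ.mdifferentiableAt (by simp)
  have hfd := hf.mdifferentiableAt (show (∞ : ℕ∞ω) ≠ 0 by simp)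
  have hg := contDiffAt_comp_chart_symm hf
  rw [← mapRep_self (E := E)] at hg
  have heq : (f ∘ φ) ∘ (extChartAt 𝓘(ℝ, E) x).symm =ᶠ[𝓝 (extChartAt 𝓘(ℝ, E) x x)]
      (f ∘ (extChartAt 𝓘(ℝ, F) (φ x)).symm) ∘ mapRep E F φ x := by
    filter_upwards [eventually_chart_symm (E := E) (eventually_map_mem_chart_source hφ x)] with u hu
    simp only [mapRep, Function.comp_apply]
    rw [(extChartAt 𝓘(ℝ, F) (φ x)).left_inv (by simpa using hu)]
  rw [hessian_apply, heq.fderiv.fderiv_eq,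
    fderiv_fderiv_comp hg (contDiffAt_mapRep (hφ x)), hessian_apply, nablaDiff_eq hφ,
    mvfderiv_comp_map hfd hφd, map_sub, map_add,
    mvfderiv_ofModel (mem_chart_source F (φ x)) hfd, toModel_mfderiv hφd, toModel_mfderiv hφd,
    mapRep_self]
  abel

end Preimage

/-! ### The trace identity and the three implications -/

variable {E : Type*} [NormedAddCommGroup E] [NormedSpace ℝ E] [FiniteDimensional ℝ E]
  {F : Type*} [NormedAddCommGroup F] [NormedSpace ℝ F] [FiniteDimensional ℝ F]
  {M : Type*} [TopologicalSpace M] [ChartedSpace E M] [IsManifold 𝓘(ℝ, E) ∞ M]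
  [RiemannianBundle (fun x : M ↦ TangentSpace 𝓘(ℝ, E) x)]
  [IsContMDiffRiemannianBundle 𝓘(ℝ, E) ∞ E (fun x : M ↦ TangentSpace 𝓘(ℝ, E) x)]
  {N : Type*} [TopologicalSpace N] [ChartedSpace F N] [IsManifold 𝓘(ℝ, F) ∞ N]
  [RiemannianBundle (fun y : N ↦ TangentSpace 𝓘(ℝ, F) y)]
  [IsContMDiffRiemannianBundle 𝓘(ℝ, F) ∞ F (fun y : N ↦ TangentSpace 𝓘(ℝ, F) y)]
  {φ : M → N} {p : ℕ} {B U : Set N} {x : M}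

/-- The trace of the Hessian of `f ∘ φ` over a preimage, for a map `φ` that is horizontally conformal
to first order. -/
lemma sum_hessian_comp_of_conformal {G : Type*} [NormedAddCommGroup G] [NormedSpace ℝ G]
    [FiniteDimensional ℝ G] {f : N → G} (hφ : IsSubmersive E F φ)
    (hf : ContMDiffAt 𝓘(ℝ, F) 𝓘(ℝ, G) ∞ f (φ x))
    {μ : Fin (Module.finrank ℝ F) → M → ℝ}
    (hμ : ∀ᶠ x' in 𝓝 x, AreNonzeroEigenvalues E F φ x' (fun i ↦ μ i x'))
    (hd : ∀ i, MDifferentiableAt 𝓘(ℝ, E) 𝓘(ℝ) (μ i) x)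
    (heq : ∀ i j, μ i x = μ j x ∧ grad (E := E) (μ i) x = grad (E := E) (μ j) x)
    (i₀ : Fin (Module.finrank ℝ F))
    {S : Submodule ℝ (TangentSpace 𝓘(ℝ, F) (φ x))}
    (hS : ∀ w ∈ S, mvfderiv 𝓘(ℝ, F) f (φ x) w = 0)
    {K : Submodule ℝ (TangentSpace 𝓘(ℝ, E) x)}
    (hK : K = S.comap (mfderiv 𝓘(ℝ, E) 𝓘(ℝ, F) φ x).toLinearMap)
    (hp : Module.finrank ℝ (Kᗮ : Submodule ℝ (TangentSpace 𝓘(ℝ, E) x)) = p) :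
    ∑ i, hessian (f ∘ φ) x (stdOrthonormalBasis ℝ K i : TangentSpace 𝓘(ℝ, E) x)
        (stdOrthonormalBasis ℝ K i : TangentSpace 𝓘(ℝ, E) x) =
      μ i₀ x • ∑ i, hessian f (φ x) (stdOrthonormalBasis ℝ S i : TangentSpace 𝓘(ℝ, F) (φ x))
        (stdOrthonormalBasis ℝ S i : TangentSpace 𝓘(ℝ, F) (φ x))
      + (diffNorm E F φ x ^ ((p : ℝ) - 2))⁻¹ •
        mvfderiv 𝓘(ℝ, F) f (φ x) (pTension E F p φ x) := by
  subst hK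
  set A := mfderiv 𝓘(ℝ, E) 𝓘(ℝ, F) φ x with hA
  have hpos : 0 < diffNorm E F φ x ^ ((p : ℝ) - 2) :=
    Real.rpow_pos_of_pos (diffNorm_pos hφ.1 hμ heq i₀) _
  have hr : 0 < μ i₀ x := (eventually_eigenvalue_pos (E := E) (F := F) hμ).self_of_nhds i₀
  have hconf : ∀ z ∈ (LinearMap.ker A.toLinearMap)ᗮ, ∀ w,
      inner ℝ (A.toLinearMap z) (A.toLinearMap w) = μ i₀ x * inner ℝ z w := fun z hz w ↦
    inner_mfderiv_mfderiv_of_mem_orthogonal hφ.1 hμ heq i₀ hz w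
  have h1 := sum_bilin_comap_eq_smul_sum (A := A.toLinearMap) (hφ.2 x) hconf S (hessian f (φ x))
    (stdOrthonormalBasis ℝ _) (stdOrthonormalBasis ℝ S)
  have h2 := sum_comap_eq_of_conformal (A := A.toLinearMap) (hφ.2 x) hr.ne' hconf
    (θ := (mvfderiv 𝓘(ℝ, F) f (φ x)).toLinearMap) hS
    (G := grad (E := E) (μ i₀) x) (β := nablaDiffBilin hφ.1 x)
    (fun v hv z hz ↦ inner_nablaDiff_of_conformal hφ.1 hμ hd heq i₀ hv hz) hp
    (stdOrthonormalBasis ℝ _) (stdOrthonormalBasis ℝ _)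
  rw [← grad_log_diffNorm hφ.1 hμ hd heq i₀] at h2
  have h3 : mvfderiv 𝓘(ℝ, F) f (φ x) (pTension E F p φ x) = diffNorm E F φ x ^ ((p : ℝ) - 2) •
      ∑ j, mvfderiv 𝓘(ℝ, F) f (φ x) (nablaDiff φ x
        (stdOrthonormalBasis ℝ (S.comap A.toLinearMap) j : TangentSpace 𝓘(ℝ, E) x)
        (stdOrthonormalBasis ℝ (S.comap A.toLinearMap) j : TangentSpace 𝓘(ℝ, E) x)) := by
    rw [pTension, map_smul]
    exact congrArg _ h2.symm
  rw [h3, inv_smul_smul₀ hpos.ne', ← h1, ← Finset.sum_add_distrib]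
  exact Finset.sum_congr rfl fun i _ ↦ hessian_comp hφ.1 hf _ _

lemma exists_sum_hessian_comp_eq (hφ : IsSubmersive E F φ) (hB : IsSubmanifold F p B)
    (hx : φ x ∈ B) (hconf : HorizontallyConformalToFirstOrderAt E F φ x)
    {f : N → EuclideanSpace ℝ (Fin p)} (hf : IsZeroSetOn F B U f) (hxU : φ x ∈ U) :
    ∃ r s : ℝ, r ≠ 0 ∧ s ≠ 0 ∧
      ∑ i, hessian (f ∘ φ) x (stdOrthonormalBasis ℝ (tangentTo E (φ ⁻¹' B) x) i :
          TangentSpace 𝓘(ℝ, E) x)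
        (stdOrthonormalBasis ℝ (tangentTo E (φ ⁻¹' B) x) i : TangentSpace 𝓘(ℝ, E) x) =
      r • ∑ i, hessian f (φ x) (stdOrthonormalBasis ℝ (tangentTo F B (φ x)) i :
          TangentSpace 𝓘(ℝ, F) (φ x))
        (stdOrthonormalBasis ℝ (tangentTo F B (φ x)) i : TangentSpace 𝓘(ℝ, F) (φ x))
      + s • mvfderiv 𝓘(ℝ, F) f (φ x) (pTension E F p φ x) := by
  -- If `dim N = 0` there is no eigenvalue to serve as `λ`; but then `p = 0` and `f` takes values in
  -- a trivial space, so any coefficients do.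
  rcases Nat.eq_zero_or_pos (Module.finrank ℝ F) with hF | hF
  · have hp : p = 0 := by
      have := (mvfderiv 𝓘(ℝ, F) f (φ x)).toLinearMap.finrank_le_finrank_of_surjective
        (hf.surjective _ hxU)
      rw [finrank_euclideanSpace_fin] at this
      exact Nat.le_zero.1 (this.trans hF.le)
    subst hp
    exact ⟨1, 1, one_ne_zero, one_ne_zero, Subsingleton.elim _ _⟩
  obtain ⟨μ, hμ, hd, heq⟩ := hconf
  have hr : 0 < μ ⟨0, hF⟩ x := (eventually_eigenvalue_pos (E := E) (F := F) hμ).self_of_nhds _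
  exact ⟨_, _, hr.ne',
    (inv_pos.2 (Real.rpow_pos_of_pos (diffNorm_pos hφ.1 hμ heq ⟨0, hF⟩) _)).ne',
    sum_hessian_comp_of_conformal hφ (hf.contMDiffAt hxU) hμ hd heq ⟨0, hF⟩
      (fun w hw ↦ (hf.mem_tangentTo_iff hxU hx w).1 hw) (tangentTo_preimage hB hφ hx)
      (finrank_orthogonal_tangentTo (hB.preimage hφ) hx)⟩

/-- Each two of the vanishing of the mean curvature of `B`, the vanishing of the mean curvature of
`φ⁻¹(B)`, and the tangency of the `p`-tension field imply the third one. -/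
lemma meanCurvature_preimage (hφ : IsSubmersive E F φ) (hB : IsSubmanifold F p B)
    (hx : φ x ∈ B) (hconf : HorizontallyConformalToFirstOrderAt E F φ x) :
    (pTension E F p φ x ∈ tangentTo F B (φ x) →
      (meanCurvature E (φ ⁻¹' B) x = 0 ↔ meanCurvature F B (φ x) = 0)) ∧
    (meanCurvature F B (φ x) = 0 → meanCurvature E (φ ⁻¹' B) x = 0 →
      pTension E F p φ x ∈ tangentTo F B (φ x)) := by
  obtain ⟨U, f, hxU, hf⟩ := hB.exists_isZeroSetOn hx
  obtain ⟨r, s, hr, hs, h⟩ := exists_sum_hessian_comp_eq hφ hB hx hconf hf hxU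
  rw [hf.mem_tangentTo_iff hxU hx, hf.meanCurvature_eq_zero_iff hxU hx,
    (hf.comp hφ).meanCurvature_eq_zero_iff hxU hx, h]
  refine ⟨fun h0 ↦ ?_, fun h1 ↦ ?_⟩
  · rw [h0, smul_zero, add_zero, smul_eq_zero_iff_right hr]
  · rw [h1, smul_zero, zero_add, smul_eq_zero_iff_right hs]
    exact id

end RiemGeom

end

theorem mainTheorem4
    {E : Type*} [NormedAddCommGroup E] [NormedSpace ℝ E] [FiniteDimensional ℝ E]
    {F : Type*} [NormedAddCommGroup F] [NormedSpace ℝ F] [FiniteDimensional ℝ F]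
    {M : Type*} [TopologicalSpace M] [ChartedSpace E M] [IsManifold 𝓘(ℝ, E) ∞ M]
    [RiemannianBundle (fun x : M ↦ TangentSpace 𝓘(ℝ, E) x)]
    [IsContMDiffRiemannianBundle 𝓘(ℝ, E) ∞ E (fun x : M ↦ TangentSpace 𝓘(ℝ, E) x)]
    {N : Type*} [TopologicalSpace N] [ChartedSpace F N] [IsManifold 𝓘(ℝ, F) ∞ N]
    [RiemannianBundle (fun y : N ↦ TangentSpace 𝓘(ℝ, F) y)]
    [IsContMDiffRiemannianBundle 𝓘(ℝ, F) ∞ F (fun y : N ↦ TangentSpace 𝓘(ℝ, F) y)]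
    (φ : M → N) (hφ : RiemGeom.IsSubmersive E F φ)
    (p : ℕ) (B : Set N) (hB : RiemGeom.IsSubmanifold F p B)
    (hconf : ∀ x ∈ φ ⁻¹' B, RiemGeom.HorizontallyConformalToFirstOrderAt E F φ x) :
    -- (i) and (ii) imply (iii)
    ((∀ x ∈ φ ⁻¹' B, RiemGeom.pTension E F p φ x ∈ RiemGeom.tangentTo F B (φ x)) →
      RiemGeom.IsMinimalSubmanifold F p B →
      RiemGeom.IsMinimalSubmanifold E p (φ ⁻¹' B)) ∧
    -- (i) and (iii) imply (ii), provided `B` lies in the image of `φ`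
    ((∀ x ∈ φ ⁻¹' B, RiemGeom.pTension E F p φ x ∈ RiemGeom.tangentTo F B (φ x)) →
      RiemGeom.IsMinimalSubmanifold E p (φ ⁻¹' B) →
      B ⊆ Set.range φ →
      RiemGeom.IsMinimalSubmanifold F p B) ∧
    -- (ii) and (iii) imply (i)
    (RiemGeom.IsMinimalSubmanifold F p B →
      RiemGeom.IsMinimalSubmanifold E p (φ ⁻¹' B) →
      ∀ x ∈ φ ⁻¹' B, RiemGeom.pTension E F p φ x ∈ RiemGeom.tangentTo F B (φ x)) := by
  have key := fun x (hx : x ∈ φ ⁻¹' B) ↦ RiemGeom.meanCurvature_preimage hφ hB hx (hconf x hx)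
  refine ⟨fun h1 h2 ↦ ⟨hB.preimage hφ, fun x hx ↦ ((key x hx).1 (h1 x hx)).2 (h2.2 _ hx)⟩,
    fun h1 h3 hr ↦ ⟨hB, fun y hy ↦ ?_⟩, fun h2 h3 x hx ↦ (key x hx).2 (h2.2 _ hx) (h3.2 x hx)⟩
  -- The pointwise equivalence lives at points of `M`, so minimality of `B` is only reached at
  -- points of the image.
  obtain ⟨x, rfl⟩ := hr hy
  exact ((key x hy).1 (h1 x hy)).1 (h3.2 x hy)
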